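/- Let $p,q:[0,1]\to\mathbb{R}_+$ be probability density functions; write $p(J)=\int_J p$ for $J\subseteq[0,1]$. For an integer $k\ge 1$ let $$\|p-q\|_{\mathcal{A}_k}=\sup\Big\{\sum_{i=1}^k|p(I_i)-q(I_i)| : I_1,\dots,I_k \text{ are disjoint intervals with union } [0,1]\Big\}.$$ For a real number $C>0$, an integer $k>2$ and $\varepsilon>0$, the simple tester sets $m=C\,k^{4/5}/\varepsilon^{6/5}$, draws independently a $\mathrm{Poi}(m)$-distributed number of i.i.d. samples from $p$ and a $\mathrm{Poi}(m)$-distributed number of i.i.d. samples from $q$, and sorts all samples in one increasing list $S$ (breaking ties uniformly at random), remembering the source of each sample. Let $Z$ be the number of pairs of successive samples in $S$ that come from the same distribution minus the number of pairs of successive samples in $S$ that come from different distributions. The tester answers NO if $Z>3\sqrt m$ and YES otherwise. **Proposition.** For every $c>0$ there is $C_0>0$ such that for all $C\ge C_0$, all integers $k>2$, all $\varepsilon\ge c\,k^{-1/6}$ and all probability densities $p,q$ on $[0,1]$, the simple tester draws in expectation $m=C\,k^{4/5}/\varepsilon^{6/5}$ samples from each of $p$ and $q$, and * if $p=q$ almost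 everywhere, it answers YES with probability at least $2/3$; * if $\|p-q\|_{\mathcal{A}_k}\ge\varepsilon$, it answers NO with probability at least $2/3$. Moreover, if $\varepsilon\le 2$ (the largest possible value of the $\mathcal{A}_k$-distance), then in each of the two cases, with probability at least $2/3$ the tester gives the stated answer and at the same time draws at most $2m$ samples from each of $p$ and $q$. -/

import Mathlib

open MeasureTheory ProbabilityTheory
open scoped NNReal ENNReal unitInterval

noncomputable section

namespace AkTesting

/-- A probability density function `[0,1] → ℝ₊` with respect to Lebesgue measure. -/
structure Density where
  /-- the underlying function -/
  pdf : I → ℝ≥0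
  measurable_pdf : Measurable pdf
  lintegral_pdf : ∫⁻ x, (pdf x : ℝ≥0∞) = 1

/-- The probability distribution on `[0,1]` with density `p`. -/
def Density.law (p : Density) : Measure I :=
  volume.withDensity fun x => (p.pdf x : ℝ≥0∞)

instance (p : Density) : IsProbabilityMeasure p.law :=
  ⟨by simp [Density.law, p.lintegral_pdf]⟩

/-- `J` is a partition of `[0,1]` into `k` intervals, listed as `J 0, …, J (k-1)`. Intervals are the
order-connected sets (open, closed or half-open; some may be degenerate or empty, which does not
affect the distance below). -/
def IsIntervalPartition (k : ℕ) (J : Fin k → Set I) : Prop :=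
  (∀ i, (J i).OrdConnected) ∧ Pairwise (fun i j => Disjoint (J i) (J j)) ∧ (⋃ i, J i) = Set.univ

/-- The `A_k`-distance: the supremum over all partitions of `[0,1]` into `k` intervals of the
`L₁`-distance `∑ᵢ |p(Iᵢ) - q(Iᵢ)|` of the reduced distributions. -/
def akDist (k : ℕ) (p q : Density) : ℝ :=
  ⨆ J : {J : Fin k → Set I // IsIntervalPartition k J},
    ∑ i, |p.law.real (J.1 i) - q.law.real (J.1 i)|

/-- Which of the two distributions a sample comes from. -/
inductive Source
  | fromP
  | fromQ
  deriving DecidableEq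

/-- A sample together with the randomness used to break ties: its value in `[0,1]`, and an
independent uniformly random priority in `[0,1]`. -/
abbrev Sample : Type := I × I

/-- An entry of the merged sample: a sample, remembering its source. -/
abbrev Labelled : Type := Sample × Source

/-- Increasing order of the values; samples of equal value are ordered by their random priorities,
that is, in a uniformly random order. -/
def precedes (a b : Labelled) : Prop :=
  a.1.1 < b.1.1 ∨ (a.1.1 = b.1.1 ∧ a.1.2 ≤ b.1.2)

instance : DecidableRel precedes := fun _ _ => Classical.propDecidable _

/-- The sorted list `S` obtained by merging the samples `Sp` from `p` and `Sq` from `q`. -/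
def merged (Sp Sq : List Sample) : List Labelled :=
  (Sp.map (fun x => (x, Source.fromP)) ++ Sq.map (fun x => (x, Source.fromQ))).insertionSort
    precedes

/-- The statistic `Z`: the number of pairs of successive samples in `S` with the same source minus
the number of pairs of successive samples with different sources. -/
def statZ (Sp Sq : List Sample) : ℤ :=
  let S := merged Sp Sq
  let pairs := S.zip S.tail
  (pairs.countP (fun e => decide (e.1.2 = e.2.2)) : ℤ)
    - (pairs.countP (fun e => decide (e.1.2 ≠ e.2.2)) : ℤ)

/-- The answer of a tester. -/
inductive Answer
  | yes
  | no

/-- The sample parameter `m = C k^{4/5} / ε^{6/5}`. -/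
def sampleParam (C : ℝ) (k : ℕ) (ε : ℝ) : ℝ :=
  C * ((k : ℝ) ^ (4 / 5 : ℝ) / ε ^ (6 / 5 : ℝ))

open Classical in
/-- The decision of the simple tester with parameter `m` on the drawn samples:
answer NO if `Z > 3 √m`, and YES otherwise. -/
def simpleTester (m : ℝ) (Sp Sq : List Sample) : Answer :=
  if (statZ Sp Sq : ℝ) > 3 * √m then Answer.no else Answer.yes

/-- A point of the sample space for one distribution: the number of samples to draw, and an infinite
sequence of samples of which that many initial terms are used. -/
abbrev Draw : Type := ℕ × (ℕ → Sample)

/-- The samples actually drawn. -/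
def Draw.samples (d : Draw) : List Sample :=
  (List.range d.1).map d.2

/-- The law of one Poissonized draw from `p`: a `Poi(m)` number of samples, and, independently of
it, i.i.d. samples with density `p`, each with an independent uniform priority. -/
def drawLaw (m : ℝ) (p : Density) : Measure Draw :=
  (poissonMeasure m.toNNReal).prod
    (Measure.infinitePi fun _ : ℕ => p.law.prod (volume : Measure I))

/-- The law of the pair of independent Poissonized draws, from `p` and from `q`, used by the
tester. -/
def testLaw (m : ℝ) (p q : Density) : Measure (Draw × Draw) :=
  (drawLaw m p).prod (drawLaw m q)

/-- The answer of the simple tester as a random variable on the sample space. -/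
def answer (m : ℝ) (ω : Draw × Draw) : Answer :=
  simpleTester m (Draw.samples ω.1) (Draw.samples ω.2)

/-- The event that at most `B` samples are drawn from each of the two distributions. -/
def drawsAtMost (B : ℝ) (ω : Draw × Draw) : Prop :=
  ((Draw.samples ω.1).length : ℝ) ≤ B ∧ ((Draw.samples ω.2).length : ℝ) ≤ B

end AkTesting

end

noncomputable section

/-! Scan the merged samples from left to right, keeping the sign `A` of the last sample (`+1` for
`p`, `-1` for `q`, `0` before the first) and the current statistic `Z`. A new sample of sign `s`
adds `A * s` to `Z` and replaces `A` by `s`. The samples form independent Poisson processes of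
intensities `m P` and `m Q`, so Mecke's formula turns this rule into a closed linear system of
integral equations (`scanSystem`) for the moments `a = E[A]`, `z = E[Z]`, `w = E[A Z]`, `v = E[Z²]`,
`b = E[A²]`. The rest is analysis of that system.

Fluctuations. In the covariance `w - a z` the unbounded terms cancel, and a barrier argument gives
`|w - a z| ≤ 2` (`abs_cov_le`). Since `(v - z²)' = m (2 (P - Q) (w - a z) + (P + Q) b)`, the
variance is at most `10 m` (`variance_le`). If `P = Q`, the equation for `v` alone gives `E[Z²] ≤ 2
m`, and Chebyshev's inequality at `3 √m` proves completeness.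

Mean. Comparing `(a²)'` with `z'` shows `z 1 ≥ m D` for the energy `D = ∫ (P + Q) a²`
(`mean_ge_energy`). On an interval, `∫ (P - Q)` equals the increment of `a` divided by `m`, plus `∫
(P + Q) a`. If the reduced distributions differ by about `ε`, one of these two contributions is
large. A large integral of `(P + Q) |a|` forces `D ≥ ε² / 32` by Cauchy-Schwarz. Large increments
force energy because `(a³)'` is bounded by `6 m (P + Q) a²`, and Hölder over `k` intervals gives `z
1 ≥ m³ ε³ / (1536 k²)` (`mean_ge`). With `m = C k^{4/5} / ε^{6/5}`, the second bound is a multiple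
of `C^{5/2} √m`. The first dominates `√m` as soon as `m ε⁴` is large, which the lower bound on `ε`
ensures. In either case `z 1 ≥ 18 √m`, and Chebyshev's inequality proves soundness. -/

namespace AkTesting

/-! ### Calculus of primitives on `[0,1]` -/

/-- On `[0,1]`, the function `F` is an integral of the integrable function `f`. -/
def IsPrimitive (f F : ℝ → ℝ) : Prop :=
  IntervalIntegrable f volume 0 1 ∧ ∀ t ∈ Set.Icc (0 : ℝ) 1, F t = F 0 + ∫ x in (0 : ℝ)..t, f x

namespace IsPrimitive

variable {f g F G : ℝ → ℝ}

lemma intervalIntegrable (hF : IsPrimitive f F) {x y : ℝ} (hx : x ∈ Set.Icc (0 : ℝ) 1)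
    (hy : y ∈ Set.Icc (0 : ℝ) 1) : IntervalIntegrable f volume x y :=
  hF.1.mono_set (by
    rw [Set.uIcc_of_le (zero_le_one' ℝ)]
    exact Set.uIcc_subset_Icc hx hy)

lemma sub_eq (hF : IsPrimitive f F) {x y : ℝ} (hx : x ∈ Set.Icc (0 : ℝ) 1)
    (hy : y ∈ Set.Icc (0 : ℝ) 1) : F y - F x = ∫ u in x..y, f u := by
  have h0 : (0 : ℝ) ∈ Set.Icc (0 : ℝ) 1 := by simp
  rw [hF.2 x hx, hF.2 y hy, ← intervalIntegral.integral_interval_sub_left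
    (hF.intervalIntegrable h0 hy) (hF.intervalIntegrable h0 hx)]
  ring

lemma continuousOn (hF : IsPrimitive f F) : ContinuousOn F (Set.Icc 0 1) := by
  have h := intervalIntegral.continuousOn_primitive_interval'
    (a := (0 : ℝ)) hF.1 (by simp)
  rw [Set.uIcc_of_le zero_le_one] at h
  exact (continuousOn_const.add h).congr fun t ht => hF.2 t ht

lemma congr_deriv (hF : IsPrimitive f F) (h : ∀ x ∈ Set.Icc (0 : ℝ) 1, f x = g x) :
    IsPrimitive g F := by
  have h' : Set.EqOn f g (Set.uIcc 0 1) := by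
    rw [Set.uIcc_of_le zero_le_one]
    exact h
  refine ⟨hF.1.congr (fun x hx => h' (Set.uIoc_subset_uIcc hx)), fun t ht => ?_⟩
  rw [hF.2 t ht]
  congr 1
  refine intervalIntegral.integral_congr fun x hx => h x ?_
  rw [Set.uIcc_of_le ht.1] at hx
  exact ⟨hx.1, hx.2.trans ht.2⟩

lemma sub (hF : IsPrimitive f F) (hG : IsPrimitive g G) :
    IsPrimitive (fun x => f x - g x) (fun x => F x - G x) := by
  have h0 : (0 : ℝ) ∈ Set.Icc (0 : ℝ) 1 := by simp
  refine ⟨hF.1.sub hG.1, fun t ht => ?_⟩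
  rw [intervalIntegral.integral_sub (hF.intervalIntegrable h0 ht) (hG.intervalIntegrable h0 ht)]
  simp only
  rw [hF.2 t ht, hG.2 t ht]
  ring

lemma neg (hF : IsPrimitive f F) : IsPrimitive (fun x => -f x) (fun x => -F x) := by
  refine ⟨hF.1.neg, fun t ht => ?_⟩
  rw [intervalIntegral.integral_neg]
  simp only
  rw [hF.2 t ht]
  ring

/-- Primitives of integrable functions are absolutely continuous, so integration by parts applies
even though the derivatives exist only almost everywhere. This lets every later identity between
moments be checked by formal differentiation. -/
lemma mul (hF : IsPrimitive f F) (hG : IsPrimitive g G) :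
    IsPrimitive (fun x => f x * G x + F x * g x) (fun x => F x * G x) := by
  have h0 : (0 : ℝ) ∈ Set.Icc (0 : ℝ) 1 := by simp
  have hU : Set.uIcc (0 : ℝ) 1 = Set.Icc 0 1 := Set.uIcc_of_le zero_le_one
  refine ⟨?_, fun t ht => ?_⟩
  · exact (hF.1.mul_continuousOn (hU ▸ hG.continuousOn)).add
      (hG.1.continuousOn_mul (hU ▸ hF.continuousOn))
  have hft := hF.intervalIntegrable h0 ht
  have hgt := hG.intervalIntegrable h0 ht
  have hac : ∀ {φ : ℝ → ℝ} (c : ℝ), IntervalIntegrable φ volume 0 t →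
      AbsolutelyContinuousOnInterval (fun y => c + ∫ x in (0 : ℝ)..y, φ x) 0 t := by
    intro φ c hφ
    have hc : AbsolutelyContinuousOnInterval (fun _ : ℝ => c) 0 t :=
      ((LipschitzWith.const c).lipschitzOnWith (s := Set.uIcc 0 t)).absolutelyContinuousOnInterval
    exact hc.add (hφ.absolutelyContinuousOnInterval_intervalIntegral (by simp))
  have key := (hac (F 0) hft).integral_deriv_mul_eq_sub (hac (G 0) hgt)
  simp only [intervalIntegral.integral_same, add_zero] at key
  rw [← hF.2 t ht, ← hG.2 t ht] at key
  have e : (∫ x in (0 : ℝ)..t, (f x * G x + F x * g x)) = F t * G t - F 0 * G 0 := by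
    rw [← key]
    apply intervalIntegral.integral_congr_ae
    filter_upwards [hft.ae_hasDerivAt_integral, hgt.ae_hasDerivAt_integral] with x h1 h2 hx
    have hx' : x ∈ Set.uIcc 0 t := Set.uIoc_subset_uIcc hx
    have hxI : x ∈ Set.Icc (0 : ℝ) 1 := by
      rw [Set.uIcc_of_le ht.1] at hx'
      exact ⟨hx'.1, hx'.2.trans ht.2⟩
    rw [((h1 hx' 0 (by simp)).const_add (F 0)).deriv, ((h2 hx' 0 (by simp)).const_add (G 0)).deriv,
      ← hF.2 x hxI, ← hG.2 x hxI]
  rw [e]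
  ring

/-- A primitive that starts below `c` and does not increase while above `c` stays below `c`. -/
lemma le_of_deriv_nonpos (hF : IsPrimitive f F) {c : ℝ} (h0 : F 0 ≤ c)
    (h : ∀ x ∈ Set.Icc (0 : ℝ) 1, c < F x → f x ≤ 0) {t : ℝ} (ht : t ∈ Set.Icc (0 : ℝ) 1) :
    F t ≤ c := by
  by_contra! hlt
  -- After the last time in `[0, t]` at which `F ≤ c`, the integrand is nonpositive, so `F` cannot
  -- climb above `c`.
  set S := {x ∈ Set.Icc 0 t | F x ≤ c}
  have hsub : Set.Icc 0 t ⊆ Set.Icc (0 : ℝ) 1 := Set.Icc_subset_Icc_right ht.2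
  have hcl : IsClosed S :=
    (hF.continuousOn.mono hsub).preimage_isClosed_of_isClosed isClosed_Icc isClosed_Iic
  have hne : S.Nonempty := ⟨0, ⟨le_rfl, ht.1⟩, h0⟩
  have hbd : BddAbove S := ⟨t, fun x hx => hx.1.2⟩
  have hmem : sSup S ∈ S := hcl.csSup_mem hne hbd
  have hpos : ∀ x ∈ Set.Ioc (sSup S) t, c < F x := by
    intro x hx
    by_contra! hx'
    exact absurd (le_csSup hbd (show x ∈ S from ⟨⟨hmem.1.1.trans hx.1.le, hx.2⟩, hx'⟩))
      (not_le.2 hx.1)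
  have e := hF.sub_eq (hsub hmem.1) ht
  rw [intervalIntegral.integral_of_le hmem.1.2] at e
  have : ∫ u in Set.Ioc (sSup S) t, f u ≤ 0 := by
    refine setIntegral_nonpos measurableSet_Ioc fun x hx => ?_
    exact h x (hsub ⟨hmem.1.1.trans hx.1.le, hx.2⟩) (hpos x hx)
  have := hmem.2
  linarith

end IsPrimitive

/-! ### Analysis of the moment system: variance and mean -/

/-- After factoring out `|u - v|`, this is `3 (u + v)² ≥ 0`. The constant is attained at `v = -u`.
-/
lemma abs_sub_pow_three_le (u v : ℝ) : |u - v| ^ 3 ≤ 4 * |u ^ 3 - v ^ 3| := by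
  have e : u ^ 3 - v ^ 3 = (u - v) * (u ^ 2 + u * v + v ^ 2) := by ring
  have hn : 0 ≤ u ^ 2 + u * v + v ^ 2 := by nlinarith [sq_nonneg (u + v), sq_nonneg u, sq_nonneg v]
  rw [e, abs_mul, abs_of_nonneg hn, pow_succ', sq_abs]
  have : (u - v) ^ 2 ≤ 4 * (u ^ 2 + u * v + v ^ 2) := by nlinarith [sq_nonneg (u + v)]
  nlinarith [abs_nonneg (u - v)]

/-- The moments `a = E[A]`, `z = E[Z]`, `w = E[A Z]`, `v = E[Z²]`, `b = E[A²]` of a scan of the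
merged Poisson samples solve a linear system; `P`, `Q` are the two densities. -/
structure ScanSystem (m : ℝ) (P Q a z w v b : ℝ → ℝ) : Prop where
  m_pos : 0 < m
  P_int : IntervalIntegrable P volume 0 1
  Q_int : IntervalIntegrable Q volume 0 1
  P_nonneg : ∀ x, 0 ≤ P x
  Q_nonneg : ∀ x, 0 ≤ Q x
  P_one : ∫ x in (0 : ℝ)..1, P x = 1
  Q_one : ∫ x in (0 : ℝ)..1, Q x = 1
  a_zero : a 0 = 0
  z_zero : z 0 = 0
  w_zero : w 0 = 0
  v_zero : v 0 = 0
  a_abs : ∀ x, |a x| ≤ 1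
  b_le : ∀ x, b x ≤ 1
  a_prim : IsPrimitive (fun x => m * ((P x - Q x) - (P x + Q x) * a x)) a
  z_prim : IsPrimitive (fun x => m * ((P x - Q x) * a x)) z
  w_prim : IsPrimitive
    (fun x => m * ((P x - Q x) * z x + (P x + Q x) * a x - (P x + Q x) * w x)) w
  v_prim : IsPrimitive (fun x => m * (2 * (P x - Q x) * w x + (P x + Q x) * b x)) v

namespace ScanSystem

variable {m : ℝ} {P Q a z w v b : ℝ → ℝ} (H : ScanSystem m P Q a z w v b)
include H

lemma abs_diff_le (x : ℝ) : |P x - Q x| ≤ P x + Q x := by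
  have := H.P_nonneg x
  have := H.Q_nonneg x
  rw [abs_le]
  constructor <;> linarith

/-- The covariance `r = w - a z` is pulled back to zero at rate `m (P + Q)` and pushed by a source
of size at most `2 m (P + Q)`; hence `2` and `-2` are barriers. -/
lemma abs_cov_le {t : ℝ} (ht : t ∈ Set.Icc (0 : ℝ) 1) : |w t - a t * z t| ≤ 2 := by
  -- The terms `(P - Q) z` of `w'` and `a' z` cancel, so `z` enters only through the covariance
  -- itself.
  have hr : IsPrimitive
      (fun x => m * ((P x + Q x) * a x - (P x - Q x) * a x ^ 2 - (P x + Q x) * (w x - a x * z x)))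
      (fun x => w x - a x * z x) :=
    (H.w_prim.sub (H.a_prim.mul H.z_prim)).congr_deriv fun x _ => by ring
  have hb : ∀ x, |(P x + Q x) * a x - (P x - Q x) * a x ^ 2| ≤ 2 * (P x + Q x) := by
    intro x
    have h1 := H.abs_diff_le x
    have h2 := H.a_abs x
    have hs : 0 ≤ P x + Q x := (abs_nonneg _).trans h1
    have h3 : |(P x + Q x) * a x| ≤ P x + Q x := by
      rw [abs_mul, abs_of_nonneg hs]
      exact mul_le_of_le_one_right hs h2
    have h4 : |(P x - Q x) * a x ^ 2| ≤ P x + Q x := by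
      rw [abs_mul, abs_pow]
      exact (mul_le_of_le_one_right (abs_nonneg _) (pow_le_one₀ (abs_nonneg _) h2)).trans h1
    calc _ ≤ |(P x + Q x) * a x| + |(P x - Q x) * a x ^ 2| := abs_sub _ _
      _ ≤ _ := by linarith
  have hm := H.m_pos
  have hs : ∀ x, 0 ≤ P x + Q x := fun x => add_nonneg (H.P_nonneg x) (H.Q_nonneg x)
  rw [abs_le']
  constructor
  · refine hr.le_of_deriv_nonpos (by simp [H.w_zero, H.a_zero]) (fun x _ hx => ?_) ht
    have := (abs_le.1 (hb x)).2
    have h5 := mul_le_mul_of_nonneg_left hx.le (hs x)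
    exact mul_nonpos_of_nonneg_of_nonpos hm.le (by linarith)
  · refine hr.neg.le_of_deriv_nonpos (by simp [H.w_zero, H.a_zero]) (fun x _ hx => ?_) ht
    have := (abs_le.1 (hb x)).1
    have h5 := mul_le_mul_of_nonneg_left hx.le (hs x)
    rw [← mul_neg]
    exact mul_nonpos_of_nonneg_of_nonpos hm.le (by linarith)

lemma sum_int : IntervalIntegrable (fun x => P x + Q x) volume 0 1 := H.P_int.add H.Q_int

lemma sum_integral : ∫ x in (0 : ℝ)..1, (P x + Q x) = 2 := by
  rw [intervalIntegral.integral_add H.P_int H.Q_int, H.P_one, H.Q_one]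
  norm_num

/-- The derivative of `v - z²` is at most `m (2 * 2 + 1) (P + Q)`, and `P + Q` has mass `2`. -/
lemma variance_le : v 1 - z 1 ^ 2 ≤ 10 * m := by
  have h1 : (1 : ℝ) ∈ Set.Icc (0 : ℝ) 1 := by simp
  have hD : IsPrimitive
      (fun x => m * (2 * (P x - Q x) * (w x - a x * z x) + (P x + Q x) * b x))
      (fun x => v x - z x * z x) :=
    (H.v_prim.sub (H.z_prim.mul H.z_prim)).congr_deriv fun x _ => by ring
  have e := hD.2 1 h1
  simp only [H.v_zero, H.z_zero, mul_zero, sub_zero, zero_add] at e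
  rw [pow_two, e]
  have hi : ∫ x in (0 : ℝ)..1, 5 * m * (P x + Q x) = 10 * m := by
    rw [intervalIntegral.integral_const_mul, H.sum_integral]
    ring
  rw [← hi]
  refine intervalIntegral.integral_mono_on zero_le_one hD.1 (H.sum_int.const_mul _) fun x hx => ?_
  have h2 := H.abs_diff_le x
  have h3 := H.abs_cov_le hx
  have hs : 0 ≤ P x + Q x := (abs_nonneg _).trans h2
  have h4 : (P x - Q x) * (w x - a x * z x) ≤ (P x + Q x) * 2 := by
    refine (le_abs_self _).trans ?_
    rw [abs_mul]
    exact mul_le_mul h2 h3 (abs_nonneg _) hs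
  have h5 : (P x + Q x) * b x ≤ P x + Q x := mul_le_of_le_one_right hs (H.b_le x)
  have := mul_le_mul_of_nonneg_left
    (show 2 * (P x - Q x) * (w x - a x * z x) + (P x + Q x) * b x ≤ 5 * (P x + Q x) by linarith)
    H.m_pos.le
  linarith

lemma second_moment_le_of_eq (hPQ : ∀ᵐ x, x ∈ Set.Icc (0 : ℝ) 1 → P x = Q x) : v 1 ≤ 2 * m := by
  have h1 : (1 : ℝ) ∈ Set.Icc (0 : ℝ) 1 := by simp
  have e := H.v_prim.2 1 h1
  rw [H.v_zero, zero_add] at e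
  have hi : ∫ x in (0 : ℝ)..1, m * (P x + Q x) = 2 * m := by
    rw [intervalIntegral.integral_const_mul, H.sum_integral]
    ring
  rw [e, ← hi]
  refine intervalIntegral.integral_mono_ae_restrict zero_le_one H.v_prim.1
    (H.sum_int.const_mul _) ?_
  refine (ae_restrict_iff' measurableSet_Icc).2 ?_
  filter_upwards [hPQ] with x hx hxI
  rw [hx hxI]
  have := H.Q_nonneg x
  have h5 : (Q x + Q x) * b x ≤ Q x + Q x := mul_le_of_le_one_right (by linarith) (H.b_le x)
  have := mul_le_mul_of_nonneg_left h5 H.m_pos.le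
  simp only [sub_self, mul_zero, zero_mul, zero_add]
  exact this

lemma energy_int : IntervalIntegrable (fun x => (P x + Q x) * a x ^ 2) volume 0 1 := by
  refine H.sum_int.mul_continuousOn ?_
  rw [Set.uIcc_of_le zero_le_one]
  exact H.a_prim.continuousOn.pow 2

lemma first_int : IntervalIntegrable (fun x => (P x + Q x) * a x) volume 0 1 := by
  refine H.sum_int.mul_continuousOn ?_
  rw [Set.uIcc_of_le zero_le_one]
  exact H.a_prim.continuousOn

/-- Since `(a²)' = 2 z' - 2 m (P + Q) a²`, integration gives `z 1 = (a 1)² / 2 + m ∫ (P + Q) a²`. -/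
lemma mean_ge_energy : m * ∫ x in (0 : ℝ)..1, (P x + Q x) * a x ^ 2 ≤ z 1 := by
  have h1 : (1 : ℝ) ∈ Set.Icc (0 : ℝ) 1 := by simp
  have h2 := (H.a_prim.mul H.a_prim).2 1 h1
  have h3 := H.z_prim.2 1 h1
  rw [H.z_zero, zero_add] at h3
  simp only [H.a_zero, mul_zero, zero_add] at h2
  have h4 : a 1 * a 1 = 2 * z 1 - 2 * (m * ∫ x in (0 : ℝ)..1, (P x + Q x) * a x ^ 2) := by
    rw [h2, h3, ← intervalIntegral.integral_const_mul, ← intervalIntegral.integral_const_mul,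
      ← intervalIntegral.integral_const_mul, ← intervalIntegral.integral_sub
        (H.z_prim.1.const_mul 2) ((H.energy_int.const_mul m).const_mul 2)]
    exact intervalIntegral.integral_congr fun x _ => by ring
  nlinarith [mul_self_nonneg (a 1)]

/-- Although `a` itself may move at small energy cost per unit of `P + Q` when it is near zero, `a³`
has derivative `3 a² a'` with `|a'| ≤ 2 m (P + Q)`, which is controlled by the energy density. The
factor `24` is `4 * 6`. -/
lemma abs_increment_pow_three_le {x y : ℝ} (hx : x ∈ Set.Icc (0 : ℝ) 1)
    (hy : y ∈ Set.Icc (0 : ℝ) 1) (hxy : x ≤ y) :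
    |a y - a x| ^ 3 ≤ 24 * m * ∫ u in x..y, (P u + Q u) * a u ^ 2 := by
  have h3 := ((H.a_prim.mul H.a_prim).mul H.a_prim).sub_eq hx hy
  have hsub : Set.uIcc x y ⊆ Set.uIcc (0 : ℝ) 1 := by
    rw [Set.uIcc_of_le (zero_le_one' ℝ)]
    exact Set.uIcc_subset_Icc hx hy
  have h4 : |a y ^ 3 - a x ^ 3| ≤ ∫ u in x..y, 6 * m * ((P u + Q u) * a u ^ 2) := by
    rw [show a y ^ 3 - a x ^ 3 = a y * a y * a y - a x * a x * a x by ring, h3]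
    refine (intervalIntegral.abs_integral_le_integral_abs hxy).trans ?_
    refine intervalIntegral.integral_mono_on hxy
      (((H.a_prim.mul H.a_prim).mul H.a_prim).intervalIntegrable hx hy).abs
      ((H.energy_int.mono_set hsub).const_mul _) fun u _ => ?_
    rw [show (m * (P u - Q u - (P u + Q u) * a u) * a u
        + a u * (m * (P u - Q u - (P u + Q u) * a u))) * a u
        + a u * a u * (m * (P u - Q u - (P u + Q u) * a u))
        = 3 * m * a u ^ 2 * ((P u - Q u) - (P u + Q u) * a u) by ring, abs_mul,
      abs_of_nonneg (mul_nonneg (mul_nonneg (by norm_num) H.m_pos.le) (sq_nonneg _))]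
    have h5 := H.abs_diff_le u
    have hs : 0 ≤ P u + Q u := (abs_nonneg _).trans h5
    have h6 : |(P u + Q u) * a u| ≤ P u + Q u := by
      rw [abs_mul, abs_of_nonneg hs]
      exact mul_le_of_le_one_right hs (H.a_abs u)
    have h7 : |(P u - Q u) - (P u + Q u) * a u| ≤ 2 * (P u + Q u) :=
      (abs_sub _ _).trans (by linarith)
    have := mul_le_mul_of_nonneg_left h7
      (mul_nonneg (mul_nonneg (zero_le_three (α := ℝ)) H.m_pos.le) (sq_nonneg (a u)))
    linarith
  rw [intervalIntegral.integral_const_mul] at h4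
  have := abs_sub_pow_three_le (a y) (a x)
  linarith

/-- The equation for `a`, solved for the discrepancy `P - Q`. -/
lemma integral_diff_eq {x y : ℝ} (hx : x ∈ Set.Icc (0 : ℝ) 1) (hy : y ∈ Set.Icc (0 : ℝ) 1) :
    ∫ u in x..y, (P u - Q u) = (a y - a x) / m + ∫ u in x..y, (P u + Q u) * a u := by
  have hsub : Set.uIcc x y ⊆ Set.uIcc (0 : ℝ) 1 := by
    rw [Set.uIcc_of_le (zero_le_one' ℝ)]
    exact Set.uIcc_subset_Icc hx hy
  have hm := H.m_pos.ne'
  rw [H.a_prim.sub_eq hx hy, intervalIntegral.integral_const_mul, mul_div_cancel_left₀ _ hm,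
    intervalIntegral.integral_sub ((H.P_int.sub H.Q_int).mono_set hsub)
      (H.first_int.mono_set hsub)]
  ring

end ScanSystem

lemma sum_integral_le_of_disjoint {ι : Type*} [Fintype ι] {x y : ι → ℝ} {F : ℝ → ℝ}
    (hx : ∀ i, x i ∈ Set.Icc (0 : ℝ) 1) (hy : ∀ i, y i ∈ Set.Icc (0 : ℝ) 1)
    (hxy : ∀ i, x i ≤ y i) (hd : Pairwise fun i j => Disjoint (Set.Ioo (x i) (y i))
      (Set.Ioo (x j) (y j)))
    (hF : IntervalIntegrable F volume 0 1) (hF0 : ∀ t, 0 ≤ F t) :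
    ∑ i, ∫ u in (x i)..(y i), F u ≤ ∫ u in (0 : ℝ)..1, F u := by
  have hi : IntegrableOn F (Set.Icc 0 1) := by
    rwa [intervalIntegrable_iff_integrableOn_Icc_of_le zero_le_one] at hF
  have hsub : ∀ i, Set.Ioo (x i) (y i) ⊆ Set.Icc 0 1 := fun i =>
    Set.Ioo_subset_Icc_self.trans (Set.Icc_subset_Icc (hx i).1 (hy i).2)
  simp_rw [fun i => intervalIntegral.integral_of_le (μ := volume) (f := F) (hxy i),
    integral_Ioc_eq_integral_Ioo]
  rw [← integral_iUnion_fintype (fun i => measurableSet_Ioo) hd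
    (fun i => hi.mono_set (hsub i)), intervalIntegral.integral_of_le zero_le_one,
    ← integral_Icc_eq_integral_Ioc]
  exact setIntegral_mono_set hi (Filter.Eventually.of_forall hF0)
    (Set.iUnion_subset hsub).eventuallyLE

namespace ScanSystem

variable {m : ℝ} {P Q a z w v b : ℝ → ℝ} (H : ScanSystem m P Q a z w v b)
include H

/-- If the reduced distributions over `k` disjoint intervals are at `L₁`-distance at least `ε/2`,
the mean of the statistic is large. -/
lemma mean_ge {k : ℕ} (hk : 0 < k) {ε : ℝ} (hε : 0 < ε) {x y : Fin k → ℝ}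
    (hx : ∀ i, x i ∈ Set.Icc (0 : ℝ) 1) (hy : ∀ i, y i ∈ Set.Icc (0 : ℝ) 1)
    (hxy : ∀ i, x i ≤ y i) (hd : Pairwise fun i j => Disjoint (Set.Ioo (x i) (y i))
      (Set.Ioo (x j) (y j)))
    (hdist : ε / 2 ≤ ∑ i, |∫ u in (x i)..(y i), (P u - Q u)|) :
    m * ε ^ 2 / 32 ≤ z 1 ∨ m ^ 3 * ε ^ 3 / (1536 * k ^ 2) ≤ z 1 := by
  have hm := H.m_pos
  have hs : ∀ u, 0 ≤ P u + Q u := fun u => add_nonneg (H.P_nonneg u) (H.Q_nonneg u)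
  have hz := H.mean_ge_energy
  set D := ∫ u in (0 : ℝ)..1, (P u + Q u) * a u ^ 2 with hD
  have habs_int : IntervalIntegrable (fun u => (P u + Q u) * |a u|) volume 0 1 := by
    refine H.sum_int.mul_continuousOn ?_
    rw [Set.uIcc_of_le zero_le_one]
    exact H.a_prim.continuousOn.abs
  set T := ∫ u in (0 : ℝ)..1, (P u + Q u) * |a u| with hT
  have hsum : ε / 2 ≤ (∑ i, |a (y i) - a (x i)|) / m + T := by
    refine hdist.trans ?_
    calc ∑ i, |∫ u in (x i)..(y i), (P u - Q u)|
        ≤ ∑ i, (|a (y i) - a (x i)| / m + ∫ u in (x i)..(y i), (P u + Q u) * |a u|) := by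
          refine Finset.sum_le_sum fun i _ => ?_
          rw [H.integral_diff_eq (hx i) (hy i)]
          refine (abs_add_le _ _).trans ?_
          rw [abs_div, abs_of_pos hm]
          refine add_le_add_right ?_ _
          refine (intervalIntegral.abs_integral_le_integral_abs (hxy i)).trans_eq ?_
          refine intervalIntegral.integral_congr fun u _ => ?_
          simp only [abs_mul, abs_of_nonneg (hs u)]
      _ ≤ _ := by
          rw [Finset.sum_add_distrib, Finset.sum_div]
          exact add_le_add_right (sum_integral_le_of_disjoint hx hy hxy hd habs_int
            fun u => mul_nonneg (hs u) (abs_nonneg _)) _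
  -- At least half of `ε / 2` comes from `T` or from the increments of `a`.
  rcases le_or_gt (ε / 4) T with hcase | hcase
  · left
    have hTD : ε / 8 * T * 2 - 2 * (ε / 8) ^ 2 ≤ D := by
      -- Linearised Cauchy-Schwarz: `2 s |a| - s² ≤ a²` with `s = ε / 8`, the best choice when `T =
      -- ε / 4`, as `P + Q` has mass `2`.
      have : ∫ u in (0 : ℝ)..1, (2 * (ε / 8) * ((P u + Q u) * |a u|) - (ε / 8) ^ 2 * (P u + Q u))
          ≤ D := by
        refine intervalIntegral.integral_mono_on zero_le_one
          ((habs_int.const_mul _).sub (H.sum_int.const_mul _)) H.energy_int fun u _ => ?_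
        have := mul_nonneg (hs u) (sq_nonneg (|a u| - ε / 8))
        rw [← sq_abs (a u)]
        nlinarith
      rw [intervalIntegral.integral_sub (habs_int.const_mul _) (H.sum_int.const_mul _),
        intervalIntegral.integral_const_mul, intervalIntegral.integral_const_mul,
        H.sum_integral] at this
      linarith
    have hD' : ε ^ 2 / 32 ≤ D := by nlinarith
    have := mul_le_mul_of_nonneg_left hD' hm.le
    linarith
  · right
    have hk' : (0 : ℝ) < k := by exact_mod_cast hk
    have h1 : m * ε / 4 ≤ ∑ i, |a (y i) - a (x i)| := by
      have : ε / 4 ≤ (∑ i, |a (y i) - a (x i)|) / m := by linarith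
      rw [le_div_iff₀ hm] at this
      linarith
    -- Power mean inequality over the `k` intervals.
    have h2 : (∑ i, |a (y i) - a (x i)|) ^ 3 ≤ (k : ℝ) ^ 2 * ∑ i, |a (y i) - a (x i)| ^ 3 := by
      have := pow_sum_div_card_le_sum_pow (s := Finset.univ)
        (f := fun i => |a (y i) - a (x i)|) (fun i _ => abs_nonneg _) 2
      rw [div_le_iff₀ (by simpa using pow_pos hk' 2)] at this
      simpa [mul_comm] using this
    have h3 : ∑ i, |a (y i) - a (x i)| ^ 3 ≤ 24 * m * D := by
      calc _ ≤ ∑ i, 24 * m * ∫ u in (x i)..(y i), (P u + Q u) * a u ^ 2 :=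
            Finset.sum_le_sum fun i _ => H.abs_increment_pow_three_le (hx i) (hy i) (hxy i)
        _ ≤ _ := by
            rw [← Finset.mul_sum]
            exact mul_le_mul_of_nonneg_left (sum_integral_le_of_disjoint hx hy hxy hd
              H.energy_int fun u => mul_nonneg (hs u) (sq_nonneg _)) (by linarith)
    -- Here `4³ * 24 = 1536`.
    have h4 : (m * ε / 4) ^ 3 ≤ (k : ℝ) ^ 2 * (24 * m * D) :=
      (pow_le_pow_left₀ (by positivity) h1 3).trans
        (h2.trans (mul_le_mul_of_nonneg_left h3 (by positivity)))
    rw [div_le_iff₀ (by positivity)]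
    have h5 := mul_le_mul_of_nonneg_left hz (show (0 : ℝ) ≤ 1536 * k ^ 2 by positivity)
    nlinarith

end ScanSystem

/-! ### The scan of a finite configuration and the statistic -/

/-- A sample value together with its source (`true` for `p`), ordered lexicographically. -/
abbrev Mark : Type := ℝ ×ₗ Bool

/-- The sign `+1` of samples from `p` and `-1` of samples from `q`. -/
def sign (c : Bool) : ℤ := cond c 1 (-1)

lemma abs_sign (c : Bool) : |sign c| = 1 := by cases c <;> rfl

/-- One step of the scan. The state consists of the sign of the last sample and of the value of the
statistic on the samples seen so far. -/
def step (st : ℤ × ℤ) (c : Bool) : ℤ × ℤ := (sign c, st.2 + st.1 * sign c)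

/-- The state after scanning a list of sources. -/
def scanList (l : List Bool) : ℤ × ℤ := l.foldl step (0, 0)

/-- The state after scanning, in increasing order, the marks of value less than `t`. -/
def scan (t : ℝ) (M : Multiset Mark) : ℤ × ℤ :=
  scanList (((M.filter fun e => (ofLex e).1 < t).sort).map fun e => (ofLex e).2)

lemma scanList_append_singleton (l : List Bool) (c : Bool) :
    scanList (l ++ [c]) = step (scanList l) c := by
  simp [scanList]

lemma abs_scanList_fst_le (l : List Bool) : |(scanList l).1| ≤ 1 := by
  rcases List.eq_nil_or_concat l with rfl | ⟨l, c, rfl⟩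
  · simp [scanList]
  · simp [scanList_append_singleton, step, abs_sign]

lemma abs_scanList_snd_le (l : List Bool) : |(scanList l).2| ≤ l.length := by
  induction l using List.reverseRecOn with
  | nil => simp [scanList]
  | append_singleton l c ih =>
    rw [scanList_append_singleton, step, List.length_append, List.length_singleton]
    have h := abs_scanList_fst_le l
    calc |(scanList l).2 + (scanList l).1 * sign c|
        ≤ |(scanList l).2| + |(scanList l).1 * sign c| := abs_add_le _ _
      _ ≤ _ := by
        rw [abs_mul, abs_sign, mul_one]
        push_cast
        exact add_le_add ih h

lemma abs_scan_fst_le (t : ℝ) (M : Multiset Mark) : |(scan t M).1| ≤ 1 := abs_scanList_fst_le _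

lemma abs_scan_snd_le (t : ℝ) (M : Multiset Mark) : |(scan t M).2| ≤ Multiset.card M := by
  refine (abs_scanList_snd_le _).trans ?_
  rw [List.length_map, Multiset.length_sort]
  exact_mod_cast Multiset.card_le_card (Multiset.filter_le _ _)

/-- The scan at time `x` sees only values strictly below `x`. This makes the Mecke integrand
insensitive to the added point. -/
lemma scan_cons_self (x : ℝ) (c : Bool) (M : Multiset Mark) :
    scan x (toLex (x, c) ::ₘ M) = scan x M := by
  simp [scan]

lemma sort_eq_of_pairwise {l : List Mark} {M : Multiset Mark} (hl : l.Pairwise (· ≤ ·))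
    (h : (l : Multiset Mark) = M) : M.sort = l := by
  refine List.Perm.eq_of_pairwise' (r := (· ≤ ·)) (Multiset.pairwise_sort _ _) hl ?_
  rw [← Multiset.coe_eq_coe, Multiset.sort_eq, h]

/-- With strictly increasing values, the prefix before `e` consists of the entries of smaller value.
Each increment thus depends on `e` and the whole configuration but not on a position in the list,
which is the form Mecke's formula requires. -/
lemma scanList_telescope (f : ℤ × ℤ → ℝ) (l : List Mark)
    (hl : l.Pairwise fun a b => (ofLex a).1 < (ofLex b).1) :
    f (scanList (l.map fun e => (ofLex e).2)) = f (0, 0) + (l.map fun e =>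
      f (step (scanList ((l.filter fun a => (ofLex a).1 < (ofLex e).1).map fun e => (ofLex e).2))
          (ofLex e).2)
        - f (scanList ((l.filter fun a => (ofLex a).1 < (ofLex e).1).map
          fun e => (ofLex e).2))).sum := by
  induction l using List.reverseRecOn with
  | nil => simp [scanList]
  | append_singleton l x ih =>
    rw [List.pairwise_append] at hl
    obtain ⟨h1, -, h2⟩ := hl
    have h3 : ∀ a ∈ l, (ofLex a).1 < (ofLex x).1 := fun a ha => h2 a ha x (by simp)
    have e1 : (l ++ [x]).filter (fun a => decide ((ofLex a).1 < (ofLex x).1)) = l := by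
      rw [List.filter_append, List.filter_eq_self.2 (by simpa using h3)]
      simp
    have e2 : ∀ a ∈ l, (l ++ [x]).filter (fun b => decide ((ofLex b).1 < (ofLex a).1)) =
        l.filter (fun b => decide ((ofLex b).1 < (ofLex a).1)) := by
      intro a ha
      rw [List.filter_append]
      simp [(h3 a ha).le]
    rw [List.map_append (l₁ := l), List.map_append (l₁ := l), List.sum_append]
    rw [List.map_congr_left (l := l) (g := fun e =>
      f (step (scanList ((l.filter fun a => (ofLex a).1 < (ofLex e).1).map fun e => (ofLex e).2))
          (ofLex e).2)
        - f (scanList ((l.filter fun a => (ofLex a).1 < (ofLex e).1).map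
          fun e => (ofLex e).2))) fun a ha => by rw [e2 a ha]]
    simp only [List.map_cons, List.map_nil, List.sum_singleton, e1, scanList_append_singleton]
    rw [← add_assoc, ← ih h1]
    ring

lemma pairwise_lt_sort {M : Multiset Mark} (hM : (M.map fun e => (ofLex e).1).Nodup) :
    M.sort.Pairwise fun a b => (ofLex a).1 < (ofLex b).1 := by
  have h1 := Multiset.pairwise_sort M (· ≤ ·)
  have h2 : (M.sort.map fun e => (ofLex e).1).Nodup := by
    rw [← Multiset.coe_nodup, ← Multiset.map_coe, Multiset.sort_eq]
    exact hM
  rw [List.Nodup, List.pairwise_map] at h2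
  refine (h1.and h2).imp ?_
  rintro a b ⟨hab, hne⟩
  rcases (Prod.Lex.le_iff.1 hab) with h | h
  · exact h
  · exact absurd h.1 hne

lemma sum_map_filter {α : Type*} (p : α → Prop) [DecidablePred p] (g : α → ℝ) (s : Multiset α) :
    ((s.filter p).map g).sum = (s.map fun e => if p e then g e else 0).sum := by
  induction s using Multiset.induction with
  | empty => simp
  | cons a s ih =>
    by_cases h : p a <;> simp [h, ih]

lemma scan_telescope (f : ℤ × ℤ → ℝ) (t : ℝ) {M : Multiset Mark}
    (hM : (M.map fun e => (ofLex e).1).Nodup) :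
    f (scan t M) = f (0, 0) + (M.map fun e => if (ofLex e).1 < t then
      f (step (scan (ofLex e).1 M) (ofLex e).2) - f (scan (ofLex e).1 M) else 0).sum := by
  set M' := M.filter fun e => (ofLex e).1 < t with hM'
  have hnd : (M'.map fun e => (ofLex e).1).Nodup :=
    Multiset.nodup_of_le (Multiset.map_le_map (Multiset.filter_le _ _)) hM
  have hscan : ∀ e ∈ M'.sort, scanList ((M'.sort.filter fun a => (ofLex a).1 < (ofLex e).1).map
      fun e => (ofLex e).2) = scan (ofLex e).1 M := by
    intro e he
    rw [Multiset.mem_sort, hM', Multiset.mem_filter] at he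
    have hsort : (M.filter fun a => (ofLex a).1 < (ofLex e).1).sort =
        M'.sort.filter fun a => (ofLex a).1 < (ofLex e).1 := by
      refine sort_eq_of_pairwise ((Multiset.pairwise_sort M' (· ≤ ·)).filter _) ?_
      rw [← Multiset.filter_coe, Multiset.sort_eq, hM', Multiset.filter_filter]
      exact Multiset.filter_congr fun a _ => ⟨fun h => h.1, fun h => ⟨h, h.trans he.2⟩⟩
    rw [scan, hsort]
  have key := scanList_telescope f M'.sort (pairwise_lt_sort hnd)
  rw [List.map_congr_left (g := fun e => f (step (scan (ofLex e).1 M) (ofLex e).2)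
    - f (scan (ofLex e).1 M)) fun e he => by rw [hscan e he]] at key
  rw [scan, key, ← Multiset.sum_coe, ← Multiset.map_coe, Multiset.sort_eq, hM']
  congr 1
  exact sum_map_filter _ _ M

/-- The configuration of marks of two lists of samples. -/
def config (L L' : List Sample) : Multiset Mark :=
  ((L.map fun x => toLex ((x.1 : ℝ), true)) ++ L'.map fun x => toLex ((x.1 : ℝ), false) :
    List Mark)

lemma card_config (L L' : List Sample) : Multiset.card (config L L') = L.length + L'.length := by
  simp [config]

/-- The mark of a labelled sample. -/
def toMark (a : Labelled) : Mark := toLex ((a.1.1 : ℝ), decide (a.2 = Source.fromP))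

/-- Each step adds the product of two successive signs, which is `1` for equal sources and `-1` for
different ones. The arbitrary initial sign and value carry the induction. -/
lemma sign_statistic (s : Source) (z : ℤ) (l : List Source) :
    ((l.map fun s => decide (s = Source.fromP)).foldl step
      (sign (decide (s = Source.fromP)), z)).2 =
    z + ((((s :: l).zip l).countP fun e => decide (e.1 = e.2) : ℕ) : ℤ)
      - ((((s :: l).zip l).countP fun e => decide (e.1 ≠ e.2) : ℕ) : ℤ) := by
  induction l generalizing s z with
  | nil => simp
  | cons x l ih =>
    simp only [List.map_cons, List.foldl_cons, List.zip_cons_cons, List.countP_cons]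
    rw [step, ih x]
    cases s <;> cases x <;> simp [sign] <;> ring

lemma scanList_snd_eq (S : List Labelled) :
    (scanList (S.map fun a => decide (a.2 = Source.fromP))).2 =
      (((S.zip S.tail).countP fun e => decide (e.1.2 = e.2.2) : ℕ) : ℤ)
        - (((S.zip S.tail).countP fun e => decide (e.1.2 ≠ e.2.2) : ℕ) : ℤ) := by
  cases S with
  | nil => simp [scanList]
  | cons x l =>
    have h := sign_statistic x.2 0 (l.map Prod.snd)
    rw [← List.map_cons (f := Prod.snd), List.zip_map, List.countP_map, List.countP_map,
      List.map_map] at h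
    rw [List.tail_cons, scanList, List.map_cons, List.foldl_cons]
    -- The initial sign is `0`, so the first sample contributes nothing.
    simp only [step, zero_mul, add_zero]
    rw [zero_add] at h
    exact h

instance : IsTrans Labelled precedes where
  trans a b c hab hbc := by
    rcases hab with h | ⟨h, h'⟩ <;> rcases hbc with g | ⟨g, g'⟩
    · exact Or.inl (h.trans g)
    · exact Or.inl (g ▸ h)
    · exact Or.inl (h ▸ g)
    · exact Or.inr ⟨h.trans g, h'.trans g'⟩

instance : Std.Total precedes where
  total a b := by
    rcases lt_trichotomy a.1.1 b.1.1 with h | h | h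
    · exact Or.inl (Or.inl h)
    · rcases le_total a.1.2 b.1.2 with g | g
      · exact Or.inl (Or.inr ⟨h, g⟩)
      · exact Or.inr (Or.inr ⟨h.symm, g⟩)
    · exact Or.inr (Or.inl h)

/-- For distinct values the order of the marks and the order `precedes` are both the order of the
values, so neither the priorities nor the lexicographic tie-break matters. -/
lemma scan_config_snd {L L' : List Sample} {t : ℝ}
    (hnd : ((config L L').map fun e => (ofLex e).1).Nodup)
    (ht : ∀ e ∈ config L L', (ofLex e).1 < t) :
    (scan t (config L L')).2 = statZ L L' := by
  have hmap : (((merged L L').map toMark : List Mark) : Multiset Mark) = config L L' := by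
    rw [config, Multiset.coe_eq_coe]
    refine ((List.perm_insertionSort _ _).map toMark).trans ?_
    rw [List.map_append, List.map_map, List.map_map]
    exact List.Perm.of_eq (by congr 1)
  have hsort : (config L L').sort = (merged L L').map toMark := by
    refine sort_eq_of_pairwise ?_ hmap
    have h1 : (merged L L').Pairwise precedes := List.pairwise_insertionSort _ _
    have h2 : ((merged L L').map fun a => (a.1.1 : ℝ)).Nodup := by
      rw [← hmap, Multiset.map_coe, List.map_map, Multiset.coe_nodup] at hnd
      exact hnd
    rw [List.Nodup, List.pairwise_map] at h2
    rw [List.pairwise_map]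
    refine (h1.and h2).imp ?_
    rintro a b ⟨hab, hne⟩
    rw [toMark, toMark, Prod.Lex.toLex_le_toLex]
    left
    rcases hab with h | h
    · exact h
    · exact absurd (congrArg Subtype.val h.1) hne
  rw [scan, Multiset.filter_eq_self.2 ht, hsort, List.map_map]
  exact scanList_snd_eq (merged L L')

/-! ### Measurability of the scan -/

lemma scan_map_univ {ι : Type*} [Fintype ι] (c : ι → Bool) (t : ℝ) (w : ι → ℝ) :
    scan t (Finset.univ.val.map fun i => toLex (w i, c i)) =
      scanList ((((Finset.univ.filter fun i => decide (w i < t) = true).toList).insertionSort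
        (fun i j => decide (toLex (w i, c i) ≤ toLex (w j, c j)) = true)).map c) := by
  have h1 : (Finset.univ.val.map fun i => toLex (w i, c i)).filter (fun e => (ofLex e).1 < t) =
      (((Finset.univ.filter fun i => decide (w i < t) = true).toList.map
        fun i => toLex (w i, c i) : List Mark) : Multiset Mark) := by
    rw [Multiset.filter_map, ← Multiset.map_coe, Finset.coe_toList, Finset.filter_val]
    congr 1
    exact Multiset.filter_congr fun i _ => by simp
  rw [scan, h1, Multiset.coe_sort, List.mergeSort_eq_insertionSort, ← List.map_insertionSort
    (r := fun i j => decide (toLex (w i, c i) ≤ toLex (w j, c j)) = true), List.map_map]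
  · rfl
  · intro i _ j _
    simp

/-- The scan factors through the finite pattern of comparisons of the values with `t` and with each
other, and each comparison is a measurable event. -/
lemma measurable_scan {ι : Type*} [Fintype ι] (c : ι → Bool) :
    Measurable fun y : ℝ × (ι → ℝ) =>
      scan y.1 (Finset.univ.val.map fun i => toLex (y.2 i, c i)) := by
  simp_rw [scan_map_univ]
  let pattern : ℝ × (ι → ℝ) → (ι → Bool) × (ι → ι → Bool) := fun y =>
    (fun i => decide (y.2 i < y.1), fun i j => decide (toLex (y.2 i, c i) ≤ toLex (y.2 j, c j)))
  have hp : Measurable pattern := by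
    refine Measurable.prodMk (measurable_pi_lambda _ fun i => ?_)
      (measurable_pi_lambda _ fun i => measurable_pi_lambda _ fun j => ?_)
    · refine measurable_to_bool ?_
      have : MeasurableSet {y : ℝ × (ι → ℝ) | y.2 i < y.1} :=
        measurableSet_lt (by fun_prop) (by fun_prop)
      convert this using 1
      ext y
      simp
    · refine measurable_to_bool ?_
      have h1 : MeasurableSet {y : ℝ × (ι → ℝ) | y.2 i < y.2 j} :=
        measurableSet_lt (by fun_prop) (by fun_prop)
      have h2 : MeasurableSet {y : ℝ × (ι → ℝ) | y.2 i = y.2 j} :=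
        measurableSet_eq_fun (by fun_prop) (by fun_prop)
      have := h1.union (h2.inter (MeasurableSet.const (c i ≤ c j)))
      convert this using 1
      ext y
      simp [Prod.Lex.toLex_le_toLex]
  exact (Measurable.of_discrete (f := fun k : (ι → Bool) × (ι → ι → Bool) =>
    scanList ((((Finset.univ.filter fun i => k.1 i = true).toList).insertionSort
        (fun i j => k.2 i j = true)).map c))).comp hp

lemma config_ofFn {n n' : ℕ} (u : Fin n → Sample) (v : Fin n' → Sample) :
    config (List.ofFn u) (List.ofFn v) = Finset.univ.val.map fun i : Fin n ⊕ Fin n' =>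
      toLex ((Sum.elim (fun i => ((u i).1 : ℝ)) (fun i => ((v i).1 : ℝ)) i : ℝ),
        (Sum.elim (fun _ => true) (fun _ => false) i : Bool)) := by
  rw [← Finset.univ_disjSum_univ, Finset.val_disjSum, Multiset.disjSum, Multiset.map_add,
    Multiset.map_map, Multiset.map_map, config, ← Multiset.coe_add, ← Multiset.map_coe,
    ← Multiset.map_coe, ← Fin.univ_val_map, ← Fin.univ_val_map, Multiset.map_map, Multiset.map_map]
  rfl

lemma measurable_scan_config (n n' : ℕ) :
    Measurable fun y : ℝ × (Fin n → Sample) × (Fin n' → Sample) =>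
      scan y.1 (config (List.ofFn y.2.1) (List.ofFn y.2.2)) := by
  simp_rw [config_ofFn]
  have h := measurable_scan (ι := Fin n ⊕ Fin n') (Sum.elim (fun _ => true) (fun _ => false))
  refine h.comp (f := fun y : ℝ × (Fin n → Sample) × (Fin n' → Sample) => (y.1,
    fun i => (Sum.elim (fun i => ((y.2.1 i).1 : ℝ)) (fun i => ((y.2.2 i).1 : ℝ)) i : ℝ)))
    (measurable_fst.prodMk (measurable_pi_lambda _ fun i => ?_))
  cases i <;> simp only [Sum.elim_inl, Sum.elim_inr] <;> fun_prop

lemma measurable_of_countable_fibers {α β κ : Type*} [MeasurableSpace α] [MeasurableSpace β]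
    [MeasurableSpace κ] [Countable κ] [MeasurableSingletonClass κ] {g : α → κ} (hg : Measurable g)
    {F : κ → α → β} (hF : ∀ k, Measurable (F k)) : Measurable fun a => F (g a) a :=
  (measurable_from_prod_countable_right (f := fun y : κ × α => F y.1 y.2) hF).comp
    (hg.prodMk measurable_id)

/-! ### Poisson sums and Mecke's formula -/

lemma lintegral_poisson (r : ℝ≥0) (F : ℕ → ℝ≥0∞) :
    ∫⁻ n, F n ∂(poissonMeasure r) =
      ∑' n, ENNReal.ofReal (Real.exp (-r) * r ^ n / n.factorial) * F n := by
  rw [poissonMeasure, lintegral_sum_measure]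
  simp_rw [lintegral_smul_measure, lintegral_dirac, smul_eq_mul]

/-- The weights satisfy `(n + 1) r^{n+1} / (n + 1)! = r * r^n / n!`. This index shift yields both
the Poisson moments and Mecke's formula. -/
lemma lintegral_poisson_succ (r : ℝ≥0) {F G : ℕ → ℝ≥0∞} (h0 : G 0 = 0)
    (hG : ∀ n, G (n + 1) = (n + 1 : ℕ) * F n) :
    ∫⁻ n, G n ∂(poissonMeasure r) = r * ∫⁻ n, F n ∂(poissonMeasure r) := by
  rw [lintegral_poisson, lintegral_poisson, tsum_eq_zero_add' ENNReal.summable, h0, mul_zero,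
    zero_add, ← ENNReal.tsum_mul_left]
  refine tsum_congr fun n => ?_
  rw [hG, ← mul_assoc, ← mul_assoc]
  congr 1
  rw [← ENNReal.ofReal_natCast, ← ENNReal.ofReal_mul (by positivity),
    ← ENNReal.ofReal_coe_nnreal, ← ENNReal.ofReal_mul (by positivity)]
  congr 1
  rw [Nat.factorial_succ, pow_succ]
  push_cast
  field_simp

lemma lintegral_poisson_id (r : ℝ≥0) : ∫⁻ n, (n : ℝ≥0∞) ∂(poissonMeasure r) = r := by
  rw [lintegral_poisson_succ r (F := fun _ => 1) (by simp) (by simp)]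
  simp

lemma lintegral_poisson_sq (r : ℝ≥0) :
    ∫⁻ n, (n : ℝ≥0∞) ^ 2 ∂(poissonMeasure r) = r * (r + 1) := by
  rw [lintegral_poisson_succ r (F := fun n => n + 1) (by simp) (fun n => by push_cast; ring),
    lintegral_add_right _ measurable_const, lintegral_poisson_id]
  simp

section Mecke

variable {X : Type*} [MeasurableSpace X] (μ : Measure X) [IsProbabilityMeasure μ]

lemma measurePreserving_initial (n : ℕ) :
    MeasurePreserving (fun (s : ℕ → X) (i : Fin n) => s i) (Measure.infinitePi fun _ : ℕ => μ)
      (Measure.pi fun _ : Fin n => μ) := by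
  refine ⟨by fun_prop, ?_⟩
  refine (Measure.pi_eq fun t ht => ?_).symm
  rw [Measure.map_apply (by fun_prop) (MeasurableSet.univ_pi ht)]
  have e : (fun (s : ℕ → X) (i : Fin n) => s i) ⁻¹' Set.univ.pi t =
      Set.pi (Finset.range n) (fun i => if h : i < n then t ⟨i, h⟩ else Set.univ) := by
    ext s
    simp only [Set.mem_preimage, Set.mem_pi, Set.mem_univ, true_imp_iff, Finset.coe_range,
      Set.mem_Iio]
    refine ⟨fun h i hi => by simpa [hi] using h ⟨i, hi⟩, fun h i => by simpa using h i i.2⟩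
  rw [e, Measure.infinitePi_pi, Finset.prod_range]
  · simp
  · intro i hi
    rw [Finset.mem_range] at hi
    simpa [hi] using ht ⟨i, hi⟩

lemma perm_ofFn_removeNth {α : Type*} {n : ℕ} (i : Fin (n + 1)) (v : Fin (n + 1) → α) :
    (List.ofFn v).Perm (v i :: List.ofFn (i.removeNth v)) := by
  rw [← Multiset.coe_eq_coe, ← Multiset.cons_coe, ← Fin.univ_val_map, ← Fin.univ_val_map,
    Fin.univ_succAbove n i, Finset.cons_val, Multiset.map_cons, Finset.map_val, Multiset.map_map]
  rfl

variable (r : ℝ≥0)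

/-- Mecke's formula for the sum over the points of a Poisson sample. -/
lemma lintegral_sum_samples (Ψ : X → List X → ℝ≥0∞)
    (hmeas : ∀ n, Measurable fun y : X × (Fin n → X) => Ψ y.1 (List.ofFn y.2))
    (hperm : ∀ x L L', L.Perm (x :: L') → Ψ x L = Ψ x L') :
    ∫⁻ d, ((List.ofFn fun i : Fin d.1 => d.2 i).map fun x =>
        Ψ x (List.ofFn fun i : Fin d.1 => d.2 i)).sum
        ∂((poissonMeasure r).prod (Measure.infinitePi fun _ : ℕ => μ)) =
      r * ∫⁻ x, ∫⁻ d, Ψ x (List.ofFn fun i : Fin d.1 => d.2 i)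
        ∂((poissonMeasure r).prod (Measure.infinitePi fun _ : ℕ => μ)) ∂μ := by
  have hm1 : Measurable fun y : X × ℕ × (ℕ → X) =>
      Ψ y.1 (List.ofFn fun i : Fin y.2.1 => y.2.2 i) :=
    measurable_of_countable_fibers (g := fun y : X × ℕ × (ℕ → X) => y.2.1) (by fun_prop)
      (F := fun n y => Ψ y.1 (List.ofFn fun i : Fin n => y.2.2 i))
      fun n => (hmeas n).comp (f := fun y : X × ℕ × (ℕ → X) => (y.1, fun i : Fin n => y.2.2 i))
        (by fun_prop)
  have hterm : ∀ n (i : Fin n), Measurable fun v : Fin n → X => Ψ (v i) (List.ofFn v) :=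
    fun n i => (hmeas n).comp (f := fun v : Fin n → X => (v i, v)) (by fun_prop)
  have hsum : ∀ n (v : Fin n → X), ((List.ofFn v).map fun x => Ψ x (List.ofFn v)).sum =
      ∑ i, Ψ (v i) (List.ofFn v) := by
    intro n v
    rw [List.map_ofFn, List.sum_ofFn]
    rfl
  simp_rw [hsum _ fun i => _]
  have hm2 : Measurable fun d : ℕ × (ℕ → X) =>
      ∑ i : Fin d.1, Ψ (d.2 i) (List.ofFn fun j : Fin d.1 => d.2 j) :=
    measurable_of_countable_fibers (g := fun d : ℕ × (ℕ → X) => d.1) (by fun_prop)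
      (F := fun n d => ∑ i : Fin n, Ψ (d.2 i) (List.ofFn fun j : Fin n => d.2 j))
      fun n => Finset.measurable_fun_sum _ fun i _ =>
        (hterm n i).comp (f := fun (d : ℕ × (ℕ → X)) (j : Fin n) => d.2 j) (by fun_prop)
  rw [lintegral_prod _ hm2.aemeasurable]
  rw [lintegral_poisson_succ r (F := fun n => ∫⁻ x, ∫⁻ s : ℕ → X,
    Ψ x (List.ofFn fun i : Fin n => s i)
    ∂(Measure.infinitePi fun _ : ℕ => μ) ∂μ)]
  · congr 1
    rw [lintegral_lintegral_swap]
    · refine lintegral_congr fun x => ?_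
      rw [lintegral_prod]
      exact (hm1.comp (measurable_const.prodMk measurable_id)).aemeasurable
    · refine Measurable.aemeasurable ?_
      have : Measurable fun y : (ℕ × X) × (ℕ → X) =>
          Ψ y.1.2 (List.ofFn fun i : Fin y.1.1 => y.2 i) :=
        hm1.comp (f := fun y : (ℕ × X) × (ℕ → X) => (y.1.2, y.1.1, y.2)) (by fun_prop)
      exact this.lintegral_prod_right'
  · simp
  · intro n
    have h1 := (measurePreserving_initial μ (n + 1)).lintegral_comp
      (Finset.measurable_fun_sum Finset.univ fun i _ => hterm (n + 1) i)
    rw [h1, lintegral_finsetSum _ fun i _ => hterm (n + 1) i]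
    -- By exchangeability all `n + 1` summands have the same integral: split off coordinate `i` and
    -- forget its position by `hperm`.
    have h2 : ∀ i : Fin (n + 1), ∫⁻ v, Ψ (v i) (List.ofFn v) ∂(Measure.pi fun _ => μ) =
        ∫⁻ x, ∫⁻ s : ℕ → X, Ψ x (List.ofFn fun i : Fin n => s i)
          ∂(Measure.infinitePi fun _ : ℕ => μ) ∂μ := by
      intro i
      have h3 := (measurePreserving_piFinSuccAbove (fun _ : Fin (n + 1) => μ) i).lintegral_comp
        (hmeas n)
      rw [lintegral_prod _ (hmeas n).aemeasurable] at h3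
      have h4 : ∀ x, ∫⁻ s : ℕ → X, Ψ x (List.ofFn fun i : Fin n => s i)
          ∂(Measure.infinitePi fun _ : ℕ => μ) =
          ∫⁻ w, Ψ x (List.ofFn w) ∂(Measure.pi fun _ : Fin n => μ) := fun x =>
        (measurePreserving_initial μ n).lintegral_comp
          (f := fun w => Ψ x (List.ofFn w)) ((hmeas n).comp (measurable_const.prodMk measurable_id))
      simp_rw [h4]
      rw [← h3]
      exact lintegral_congr fun v => hperm _ _ _ (perm_ofFn_removeNth i v)
    rw [Finset.sum_congr rfl fun i _ => h2 i]
    simp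

end Mecke

lemma Draw.samples_eq_ofFn (d : Draw) : d.samples = List.ofFn fun i : Fin d.1 => d.2 i := by
  rw [Draw.samples, List.ofFn_eq_map, ← List.map_coe_finRange_eq_range, List.map_map]
  rfl

instance (m : ℝ) (p : Density) : IsProbabilityMeasure (drawLaw m p) := by
  unfold drawLaw; infer_instance

instance (m : ℝ) (p q : Density) : IsProbabilityMeasure (testLaw m p q) := by
  unfold testLaw; infer_instance

/-- The state of the scan of all samples at time `t`. -/
def drawScan (t : ℝ) (ω : Draw × Draw) : ℤ × ℤ := scan t (config ω.1.samples ω.2.samples)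

lemma measurable_drawScan : Measurable fun y : ℝ × Draw × Draw => drawScan y.1 y.2 := by
  simp_rw [drawScan, Draw.samples_eq_ofFn]
  refine measurable_of_countable_fibers
    (g := fun y : ℝ × Draw × Draw => (y.2.1.1, y.2.2.1)) (by fun_prop)
    (F := fun n y => scan y.1 (config (List.ofFn fun i : Fin n.1 => y.2.1.2 i)
      (List.ofFn fun i : Fin n.2 => y.2.2.2 i))) fun n => ?_
  exact (measurable_scan_config n.1 n.2).comp (f := fun y : ℝ × Draw × Draw =>
    (y.1, (fun i : Fin n.1 => y.2.1.2 i), fun i : Fin n.2 => y.2.2.2 i)) (by fun_prop)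

lemma config_perm_cons_left {x : Sample} {L L' : List Sample} (h : L.Perm (x :: L'))
    (L₂ : List Sample) : config L L₂ = toLex ((x.1 : ℝ), true) ::ₘ config L' L₂ := by
  rw [config, config, Multiset.cons_coe, Multiset.coe_eq_coe, ← List.cons_append]
  exact (h.map _).append_right _

lemma config_perm_cons_right {x : Sample} {L L' : List Sample} (h : L.Perm (x :: L'))
    (L₁ : List Sample) : config L₁ L = toLex ((x.1 : ℝ), false) ::ₘ config L₁ L' := by
  rw [config, config, Multiset.cons_coe, Multiset.coe_eq_coe]
  exact ((h.map _).append_left _).trans List.perm_middle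

lemma lintegral_sample_fst (p : Density) {F : I → ℝ≥0∞} (hF : Measurable F) :
    ∫⁻ x : Sample, F x.1 ∂(p.law.prod volume) = ∫⁻ x, F x ∂p.law := by
  rw [lintegral_prod _ (by fun_prop)]
  simp

lemma measurable_sum_samples {φ : Sample × Draw × Draw → ℝ≥0∞} (hφ : Measurable φ)
    {pr : Draw × Draw → Draw} (hpr : Measurable pr) :
    Measurable fun ω : Draw × Draw => ((pr ω).samples.map fun x => φ (x, ω)).sum := by
  refine measurable_of_countable_fibers (g := fun ω : Draw × Draw => (pr ω).1) (by fun_prop)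
    (F := fun n ω => (((List.range n).map (pr ω).2).map fun x => φ (x, ω)).sum) fun n => ?_
  simp only [List.map_map]
  have : ∀ ω, ((List.range n).map ((fun x => φ (x, ω)) ∘ (pr ω).2)).sum =
      ∑ i ∈ Finset.range n, φ ((pr ω).2 i, ω) := fun ω => rfl
  simp_rw [this]
  exact Finset.measurable_fun_sum _ fun i _ => hφ.comp (by fun_prop)

lemma lintegral_sum_draw (m : ℝ) (p : Density) (Ψ : Sample → List Sample → ℝ≥0∞)
    (hmeas : ∀ n, Measurable fun y : Sample × (Fin n → Sample) => Ψ y.1 (List.ofFn y.2))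
    (hperm : ∀ x L L', L.Perm (x :: L') → Ψ x L = Ψ x L') :
    ∫⁻ d : Draw, (d.samples.map fun x => Ψ x d.samples).sum ∂(drawLaw m p) =
      ENNReal.ofReal m * ∫⁻ x, ∫⁻ d : Draw, Ψ x d.samples ∂(drawLaw m p)
        ∂(p.law.prod (volume : Measure I)) := by
  simp only [Draw.samples_eq_ofFn]
  exact lintegral_sum_samples (p.law.prod (volume : Measure I)) m.toNNReal Ψ hmeas hperm

section Triple

variable {α β γ : Type*} [MeasurableSpace α] [MeasurableSpace β] [MeasurableSpace γ]
  (μ : Measure α) (ν : Measure β) (ρ : Measure γ) [SFinite μ] [SFinite ν] [SFinite ρ]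
  {φ : α × β × γ → ℝ≥0∞}

lemma lintegral_triple_left (hφ : Measurable φ) :
    ∫⁻ c, ∫⁻ a, ∫⁻ b, φ (a, b, c) ∂ν ∂μ ∂ρ = ∫⁻ a, ∫⁻ y, φ (a, y) ∂(ν.prod ρ) ∂μ := by
  have h : Measurable fun y : (γ × α) × β => φ (y.1.2, y.2, y.1.1) := hφ.comp (by fun_prop)
  rw [lintegral_lintegral_swap h.lintegral_prod_right'.aemeasurable]
  refine lintegral_congr fun a => ?_
  rw [lintegral_prod_symm]
  exact (hφ.comp (measurable_const.prodMk measurable_id)).aemeasurable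

lemma lintegral_triple_right (hφ : Measurable φ) :
    ∫⁻ b, ∫⁻ a, ∫⁻ c, φ (a, b, c) ∂ρ ∂μ ∂ν = ∫⁻ a, ∫⁻ y, φ (a, y) ∂(ν.prod ρ) ∂μ := by
  have h : Measurable fun y : (β × α) × γ => φ (y.1.2, y.1.1, y.2) := hφ.comp (by fun_prop)
  rw [lintegral_lintegral_swap h.lintegral_prod_right'.aemeasurable]
  refine lintegral_congr fun a => ?_
  rw [lintegral_prod]
  exact (hφ.comp (measurable_const.prodMk measurable_id)).aemeasurable

end Triple

section TestMecke

variable (m : ℝ) (p q : Density) {g : ℝ → ℝ≥0∞} (hg : Measurable g) (K : ℤ × ℤ → ℝ≥0∞)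
include hg

lemma measurable_test_integrand :
    Measurable fun y : Sample × Draw × Draw => g y.1.1 * K (drawScan y.1.1 y.2) :=
  (hg.comp (by fun_prop)).mul ((Measurable.of_discrete (f := K)).comp
    (measurable_drawScan.comp (f := fun y : Sample × Draw × Draw => ((y.1.1 : ℝ), y.2))
      (by fun_prop)))

lemma lintegral_test_integrand (r : Density) :
    ∫⁻ x : Sample, ∫⁻ ω, g x.1 * K (drawScan x.1 ω) ∂(testLaw m p q) ∂(r.law.prod volume) =
      ∫⁻ x : I, g x * ∫⁻ ω, K (drawScan x ω) ∂(testLaw m p q) ∂r.law := by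
  have hK : ∀ x : ℝ, Measurable fun ω => K (drawScan x ω) := fun x =>
    (Measurable.of_discrete (f := K)).comp (measurable_drawScan.comp
      (measurable_const.prodMk measurable_id))
  simp_rw [fun x : Sample => lintegral_const_mul (μ := testLaw m p q) (g x.1) (hK x.1)]
  refine lintegral_sample_fst r (F := fun x : I =>
    g x * ∫⁻ ω, K (drawScan x ω) ∂(testLaw m p q)) ?_
  refine (hg.comp (by fun_prop)).mul ?_
  refine Measurable.lintegral_prod_right' (f := fun y : I × Draw × Draw =>
    K (drawScan y.1 y.2)) ?_
  exact (Measurable.of_discrete (f := K)).comp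
    (measurable_drawScan.comp (f := fun y : I × Draw × Draw => ((y.1 : ℝ), y.2)) (by fun_prop))

/-- Mecke's formula is applied to the first draw with the second one frozen; Tonelli then restores
the joint law. -/
lemma lintegral_sum_fst :
    ∫⁻ ω, (ω.1.samples.map fun x => g x.1 * K (drawScan x.1 ω)).sum ∂(testLaw m p q) =
      ENNReal.ofReal m * ∫⁻ x : I, g x * ∫⁻ ω, K (drawScan x ω) ∂(testLaw m p q) ∂p.law := by
  have hφ := measurable_test_integrand hg K
  have h1 := fun ω₂ : Draw => lintegral_sum_draw m p
    (fun x L => g x.1 * K (scan x.1 (config L ω₂.samples))) (fun n => by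
      refine (hg.comp (by fun_prop)).mul ((Measurable.of_discrete (f := K)).comp ?_)
      rw [Draw.samples_eq_ofFn]
      exact (measurable_scan_config n ω₂.1).comp (f := fun y : Sample × (Fin n → Sample) =>
        ((y.1.1 : ℝ), y.2, fun i : Fin ω₂.1 => ω₂.2 i)) (by fun_prop))
    (fun x L L' h => by simp only [config_perm_cons_left h, scan_cons_self])
  rw [← lintegral_test_integrand m p q hg K p]
  unfold testLaw
  rw [← lintegral_triple_left _ _ _ hφ, lintegral_prod_symm _
    (measurable_sum_samples hφ measurable_fst).aemeasurable,
    ← lintegral_const_mul' _ _ ENNReal.ofReal_ne_top]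
  exact lintegral_congr h1

lemma lintegral_sum_snd :
    ∫⁻ ω, (ω.2.samples.map fun x => g x.1 * K (drawScan x.1 ω)).sum ∂(testLaw m p q) =
      ENNReal.ofReal m * ∫⁻ x : I, g x * ∫⁻ ω, K (drawScan x ω) ∂(testLaw m p q) ∂q.law := by
  have hφ := measurable_test_integrand hg K
  have h1 := fun ω₁ : Draw => lintegral_sum_draw m q
    (fun x L => g x.1 * K (scan x.1 (config ω₁.samples L))) (fun n => by
      refine (hg.comp (by fun_prop)).mul ((Measurable.of_discrete (f := K)).comp ?_)
      rw [Draw.samples_eq_ofFn]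
      exact (measurable_scan_config ω₁.1 n).comp (f := fun y : Sample × (Fin n → Sample) =>
        ((y.1.1 : ℝ), (fun i : Fin ω₁.1 => ω₁.2 i), y.2)) (by fun_prop))
    (fun x L L' h => by simp only [config_perm_cons_right h, scan_cons_self])
  rw [← lintegral_test_integrand m p q hg K q]
  unfold testLaw
  rw [← lintegral_triple_right _ _ _ hφ, lintegral_prod _
    (measurable_sum_samples hφ measurable_snd).aemeasurable,
    ← lintegral_const_mul' _ _ ENNReal.ofReal_ne_top]
  exact lintegral_congr h1

end TestMecke

/-! ### Almost sure distinctness of the sample values -/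

instance : NullSingletonClass (volume : Measure I) := by
  refine ⟨fun x => ?_⟩
  rw [Measure.Subtype.volume_def, comap_subtype_coe_apply measurableSet_Icc]
  simp

instance (p : Density) : NullSingletonClass p.law := by
  refine ⟨fun x => ?_⟩
  exact withDensity_absolutelyContinuous _ _ (measure_singleton x)

lemma ae_ne_of_indepFun {Ω β : Type*} [MeasurableSpace Ω] [MeasurableSpace β]
    [MeasurableEq β] {μ : Measure Ω} [IsFiniteMeasure μ] {X Y : Ω → β}
    (hX : Measurable X) (hY : Measurable Y) (h : IndepFun X Y μ) [NullSingletonClass (μ.map Y)] :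
    ∀ᵐ ω ∂μ, X ω ≠ Y ω := by
  have hd : MeasurableSet {z : β × β | z.1 = z.2} := 
    measurableSet_diagonal
  have h1 : (μ.map fun ω => (X ω, Y ω)) {z : β × β | z.1 = z.2} = 0 := by
    rw [h.map_prod_eq_prod_map_map hX.aemeasurable hY.aemeasurable, Measure.measure_prod_null hd]
    refine Filter.Eventually.of_forall fun x => ?_
    have : Prod.mk x ⁻¹' {z : β × β | z.1 = z.2} = {x} := by
      ext y
      simp [eq_comm]
    simp only [this, measure_singleton, Pi.zero_apply]
  rw [Measure.map_apply (hX.prodMk hY) hd] at h1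
  rw [ae_iff]
  simpa using h1

section Distinct

variable (m : ℝ) (p q : Density)

lemma map_sample_fst (i : ℕ) :
    (Measure.infinitePi fun _ : ℕ => p.law.prod (volume : Measure I)).map (fun s => (s i).1) =
      p.law := by
  have h : (fun s : ℕ → Sample => (s i).1) = Prod.fst ∘ fun s => s i := rfl
  rw [h, ← Measure.map_map measurable_fst (measurable_pi_apply i), Measure.infinitePi_map_eval,
    Measure.map_fst_prod]
  simp

lemma ae_sequence_injective :
    ∀ᵐ s : ℕ → Sample ∂(Measure.infinitePi fun _ : ℕ => p.law.prod (volume : Measure I)),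
      Function.Injective fun i => (s i).1 := by
  have h : ∀ i j : ℕ, i ≠ j →
      ∀ᵐ s : ℕ → Sample ∂(Measure.infinitePi fun _ : ℕ => p.law.prod (volume : Measure I)),
        (s i).1 ≠ (s j).1 := by
    intro i j hij
    have hi := (iIndepFun_infinitePi (P := fun _ : ℕ => p.law.prod (volume : Measure I))
      (X := fun _ => Prod.fst) (fun _ => measurable_fst)).indepFun hij
    have : NullSingletonClass ((Measure.infinitePi fun _ : ℕ => p.law.prod (volume : Measure I)).map
        fun s => (s j).1) := by
      rw [map_sample_fst]
      infer_instance
    exact ae_ne_of_indepFun (by fun_prop) (by fun_prop) hi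
  simp_rw [Function.Injective]
  rw [ae_all_iff]
  intro i
  rw [ae_all_iff]
  intro j
  by_cases hij : i = j
  · simp [hij]
  · filter_upwards [h i j hij] with s hs h'
    exact absurd h' hs

lemma measurePreserving_sequence :
    MeasurePreserving Prod.snd (drawLaw m p)
      (Measure.infinitePi fun _ : ℕ => p.law.prod (volume : Measure I)) :=
  measurePreserving_snd

lemma ae_cross_ne : ∀ᵐ ω ∂(testLaw m p q), ∀ i j : ℕ, (ω.1.2 i).1 ≠ (ω.2.2 j).1 := by
  rw [ae_all_iff]
  intro i
  rw [ae_all_iff]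
  intro j
  have h : IndepFun (fun ω : Draw × Draw => (ω.1.2 i).1) (fun ω => (ω.2.2 j).1)
      (testLaw m p q) :=
    indepFun_prod (X := fun d : Draw => (d.2 i).1) (Y := fun d : Draw => (d.2 j).1)
      (by fun_prop) (by fun_prop)
  have : NullSingletonClass ((testLaw m p q).map fun ω => (ω.2.2 j).1) := by
    have e : (fun ω : Draw × Draw => (ω.2.2 j).1) =
        (fun s : ℕ → Sample => (s j).1) ∘ (Prod.snd ∘ Prod.snd) := rfl
    have hq : MeasurePreserving (Prod.snd ∘ Prod.snd) (testLaw m p q) _ :=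
      (measurePreserving_sequence m q).comp measurePreserving_snd
    rw [e, ← Measure.map_map (by fun_prop) (by fun_prop), hq.map_eq, map_sample_fst]
    infer_instance
  exact ae_ne_of_indepFun (by fun_prop) (by fun_prop) h

/-- The scan at time `1` omits samples of value exactly `1`; these have probability zero. -/
lemma ae_sequence_ne_one :
    ∀ᵐ s : ℕ → Sample ∂(Measure.infinitePi fun _ : ℕ => p.law.prod (volume : Measure I)),
      ∀ i, (s i).1 ≠ 1 := by
  rw [ae_all_iff]
  intro i
  have h : ∀ᵐ x ∂p.law, x ≠ (1 : I) := by simp [ae_iff]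
  rw [← map_sample_fst p i] at h
  exact ae_of_ae_map (p := fun x => x ≠ (1 : I))
    (f := fun s : ℕ → Sample => (s i).1) (measurable_pi_apply i).fst.aemeasurable h

/-- Almost surely, no two samples have the same value, and all values are less than `1`. -/
lemma ae_config :
    ∀ᵐ ω ∂(testLaw m p q),
      ((config ω.1.samples ω.2.samples).map fun e => (ofLex e).1).Nodup ∧
        ∀ e ∈ config ω.1.samples ω.2.samples, (ofLex e).1 < 1 := by
  have hp : MeasurePreserving (fun ω : Draw × Draw => ω.1.2) (testLaw m p q) _ :=
    (measurePreserving_sequence m p).comp measurePreserving_fst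
  have hq : MeasurePreserving (fun ω : Draw × Draw => ω.2.2) (testLaw m p q) _ :=
    (measurePreserving_sequence m q).comp measurePreserving_snd
  filter_upwards [ae_cross_ne m p q, hp.quasiMeasurePreserving.ae (ae_sequence_injective p),
    hq.quasiMeasurePreserving.ae (ae_sequence_injective q),
    hp.quasiMeasurePreserving.ae (ae_sequence_ne_one p),
    hq.quasiMeasurePreserving.ae (ae_sequence_ne_one q)] with ω hc hip hiq h1p h1q
  have hlt : ∀ x : I, x ≠ 1 → (x : ℝ) < 1 := fun x hx =>
    lt_of_le_of_ne x.2.2 fun h => hx (Subtype.ext h)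
  have hinj : ∀ {s : ℕ → Sample} (n : ℕ), (Function.Injective fun i => (s i).1) →
      ((List.range n).map fun i => ((s i).1 : ℝ)).Nodup := fun n h =>
    List.nodup_range.map fun i j hij => h (Subtype.ext hij)
  constructor
  · rw [config, Multiset.map_coe, Multiset.coe_nodup, List.map_append, List.map_map, List.map_map,
      Draw.samples, Draw.samples, List.map_map, List.map_map, List.nodup_append]
    refine ⟨hinj _ hip, hinj _ hiq, ?_⟩
    simp only [List.mem_map]
    rintro _ ⟨i, -, rfl⟩ _ ⟨j, -, rfl⟩ h
    exact hc i j (Subtype.ext h)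
  · intro e he
    simp only [config, Draw.samples, Multiset.mem_coe, List.mem_append, List.mem_map] at he
    rcases he with ⟨_, ⟨i, -, rfl⟩, rfl⟩ | ⟨_, ⟨i, -, rfl⟩, rfl⟩
    · exact hlt _ (h1p i)
    · exact hlt _ (h1q i)

lemma ae_drawScan_one :
    ∀ᵐ ω ∂(testLaw m p q), (drawScan 1 ω).2 = statZ ω.1.samples ω.2.samples := by
  filter_upwards [ae_config m p q] with ω hω
  exact scan_config_snd hω.1 hω.2

end Distinct

/-! ### Moments of the sample sizes -/

section Counts

variable (m : ℝ) (p q : Density)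

lemma Draw.length_samples (d : Draw) : d.samples.length = d.1 := by simp [Draw.samples]

lemma measurePreserving_count :
    MeasurePreserving Prod.fst (drawLaw m p) (poissonMeasure m.toNNReal) :=
  measurePreserving_fst

lemma measurePreserving_count_fst :
    MeasurePreserving (fun ω : Draw × Draw => ω.1.1) (testLaw m p q)
      (poissonMeasure m.toNNReal) :=
  (measurePreserving_count m p).comp measurePreserving_fst

lemma measurePreserving_count_snd :
    MeasurePreserving (fun ω : Draw × Draw => ω.2.1) (testLaw m p q)
      (poissonMeasure m.toNNReal) :=
  (measurePreserving_count m q).comp measurePreserving_snd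

lemma lintegral_length_fst :
    ∫⁻ ω, (ω.1.samples.length : ℝ≥0∞) ∂(testLaw m p q) = ENNReal.ofReal m := by
  simp_rw [Draw.length_samples]
  rw [(measurePreserving_count_fst m p q).lintegral_comp (f := fun n => (n : ℝ≥0∞))
    Measurable.of_discrete, lintegral_poisson_id]
  rfl

lemma lintegral_length_snd :
    ∫⁻ ω, (ω.2.samples.length : ℝ≥0∞) ∂(testLaw m p q) = ENNReal.ofReal m := by
  simp_rw [Draw.length_samples]
  rw [(measurePreserving_count_snd m p q).lintegral_comp (f := fun n => (n : ℝ≥0∞))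
    Measurable.of_discrete, lintegral_poisson_id]
  rfl

lemma integrable_poisson_sq (r : ℝ≥0) :
    Integrable (fun n : ℕ => (n : ℝ) ^ 2) (poissonMeasure r) := by
  refine ⟨Measurable.of_discrete.aestronglyMeasurable, ?_⟩
  rw [hasFiniteIntegral_iff_ofReal (Filter.Eventually.of_forall fun n => by positivity)]
  have : ∀ n : ℕ, ENNReal.ofReal ((n : ℝ) ^ 2) = (n : ℝ≥0∞) ^ 2 := fun n => by
    rw [ENNReal.ofReal_pow (by positivity), ENNReal.ofReal_natCast]
  simp_rw [this]
  rw [lintegral_poisson_sq]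
  exact ENNReal.mul_lt_top ENNReal.coe_lt_top (ENNReal.add_lt_top.2 ⟨ENNReal.coe_lt_top, by simp⟩)

/-- The square of the number of samples (plus one) is integrable. -/
lemma integrable_count_sq :
    Integrable (fun ω : Draw × Draw => (1 + (ω.1.1 + ω.2.1 : ℝ)) ^ 2) (testLaw m p q) := by
  have h1 : Integrable (fun ω : Draw × Draw => (ω.1.1 : ℝ) ^ 2) (testLaw m p q) :=
    (measurePreserving_count_fst m p q).integrable_comp_of_integrable
      (integrable_poisson_sq m.toNNReal)
  have h2 : Integrable (fun ω : Draw × Draw => (ω.2.1 : ℝ) ^ 2) (testLaw m p q) :=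
    (measurePreserving_count_snd m p q).integrable_comp_of_integrable
      (integrable_poisson_sq m.toNNReal)
  -- The bound is `(1 + x + y)² ≤ 3 (1 + x² + y²)`.
  refine (((integrable_const (1 : ℝ)).add (h1.add h2)).const_mul 3).mono' ?_
    (Filter.Eventually.of_forall fun ω => ?_)
  · have : Measurable fun n : ℕ => (n : ℝ) := Measurable.of_discrete
    exact ((measurable_const.add ((this.comp (by fun_prop)).add
      (this.comp (by fun_prop)))).pow_const 2).aestronglyMeasurable
  · rw [Real.norm_of_nonneg (by positivity)]
    simp only [Pi.add_apply]
    nlinarith [sq_nonneg ((ω.1.1 : ℝ) - ω.2.1), sq_nonneg ((ω.1.1 : ℝ) - 1),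
      sq_nonneg ((ω.2.1 : ℝ) - 1)]

end Counts

/-! ### Expectations along the scan and the forward equation -/

/-- `f` grows at most quadratically on the states that a scan can reach. -/
def QuadraticGrowth (f : ℤ × ℤ → ℝ) : Prop :=
  ∃ K : ℝ, 0 ≤ K ∧ ∀ st : ℤ × ℤ, |st.1| ≤ 1 → |f st| ≤ K * (1 + |(st.2 : ℝ)|) ^ 2

/-- The increment of `f` when a sample from source `c` is scanned. -/
def jump (f : ℤ × ℤ → ℝ) (c : Bool) (st : ℤ × ℤ) : ℝ := f (step st c) - f st

lemma QuadraticGrowth.neg {f : ℤ × ℤ → ℝ} (hf : QuadraticGrowth f) :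
    QuadraticGrowth fun st => -f st := by
  obtain ⟨K, hK, h⟩ := hf
  exact ⟨K, hK, fun st hst => by simpa using h st hst⟩

lemma QuadraticGrowth.jump {f : ℤ × ℤ → ℝ} (hf : QuadraticGrowth f) (c : Bool) :
    QuadraticGrowth (jump f c) := by
  obtain ⟨K, hK, h⟩ := hf
  -- A step changes the statistic by at most `1`, so `1 + |value|` at most doubles; `5 = 4 + 1`.
  refine ⟨5 * K, by positivity, fun st hst => ?_⟩
  have h1 := h st hst
  have h2 := h (step st c) (abs_sign c).le
  have h3 : |((step st c).2 : ℝ)| ≤ |(st.2 : ℝ)| + 1 := by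
    have : |st.2 + st.1 * sign c| ≤ |st.2| + 1 := by
      refine (abs_add_le _ _).trans ?_
      rw [abs_mul, abs_sign, mul_one]
      linarith
    exact_mod_cast this
  have h4 : (1 + |((step st c).2 : ℝ)|) ^ 2 ≤ 4 * (1 + |(st.2 : ℝ)|) ^ 2 := by
    have : 1 + |((step st c).2 : ℝ)| ≤ 2 * (1 + |(st.2 : ℝ)|) := by
      have := abs_nonneg (st.2 : ℝ)
      linarith
    calc _ ≤ (2 * (1 + |(st.2 : ℝ)|)) ^ 2 := pow_le_pow_left₀ (by positivity) this 2
      _ = _ := by ring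
  calc |f (step st c) - f st| ≤ |f (step st c)| + |f st| := abs_sub _ _
    _ ≤ K * (4 * (1 + |(st.2 : ℝ)|) ^ 2) + K * (1 + |(st.2 : ℝ)|) ^ 2 :=
        add_le_add (h2.trans (mul_le_mul_of_nonneg_left h4 hK)) h1
    _ = _ := by ring

section Expectation

variable (m : ℝ) (p q : Density)

/-- The expectation of a function of the state of the scan at time `t`. -/
def scanMean (f : ℤ × ℤ → ℝ) (t : ℝ) : ℝ := ∫ ω, f (drawScan t ω) ∂(testLaw m p q)

variable {f : ℤ × ℤ → ℝ}

lemma measurable_comp_drawScan {β : Type*} [MeasurableSpace β] (f : ℤ × ℤ → β) (t : ℝ) :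
    Measurable fun ω => f (drawScan t ω) :=
  (Measurable.of_discrete (f := f)).comp (measurable_drawScan.comp
      (measurable_const.prodMk measurable_id))

lemma QuadraticGrowth.abs_drawScan_le (hf : QuadraticGrowth f) :
    ∃ K : ℝ, 0 ≤ K ∧ ∀ t ω, |f (drawScan t ω)| ≤ K * (1 + (ω.1.1 + ω.2.1 : ℝ)) ^ 2 := by
  obtain ⟨K, hK, h⟩ := hf
  refine ⟨K, hK, fun t ω => (h _ (abs_scan_fst_le _ _)).trans ?_⟩
  refine mul_le_mul_of_nonneg_left (pow_le_pow_left₀ (by positivity) ?_ 2) hK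
  have := abs_scan_snd_le t (config ω.1.samples ω.2.samples)
  rw [card_config, Draw.length_samples, Draw.length_samples] at this
  have h' : |((drawScan t ω).2 : ℝ)| ≤ ω.1.1 + ω.2.1 := by
    rw [drawScan]
    exact_mod_cast this
  rw [drawScan] at h'
  linarith

lemma QuadraticGrowth.integrable (hf : QuadraticGrowth f) (t : ℝ) :
    Integrable (fun ω => f (drawScan t ω)) (testLaw m p q) := by
  obtain ⟨K, hK, h⟩ := hf.abs_drawScan_le
  exact ((integrable_count_sq m p q).const_mul K).mono'
    (measurable_comp_drawScan f t).aestronglyMeasurable (Filter.Eventually.of_forall (h t))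

lemma QuadraticGrowth.exists_scanMean_le (hf : QuadraticGrowth f) :
    ∃ B : ℝ, ∀ t, |scanMean m p q f t| ≤ B := by
  obtain ⟨K, hK, h⟩ := hf.abs_drawScan_le
  refine ⟨∫ ω, K * (1 + (ω.1.1 + ω.2.1 : ℝ)) ^ 2 ∂(testLaw m p q), fun t => ?_⟩
  refine abs_integral_le_integral_abs.trans ?_
  exact integral_mono (hf.integrable m p q t).abs ((integrable_count_sq m p q).const_mul K) (h t)

lemma QuadraticGrowth.exists_lintegral_le (hf : QuadraticGrowth f) :
    ∃ B : ℝ≥0∞, B ≠ ∞ ∧ ∀ t, ∫⁻ ω, ENNReal.ofReal (f (drawScan t ω)) ∂(testLaw m p q) ≤ B := by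
  obtain ⟨K, hK, h⟩ := hf.abs_drawScan_le
  refine ⟨∫⁻ ω, ENNReal.ofReal (K * (1 + (ω.1.1 + ω.2.1 : ℝ)) ^ 2) ∂(testLaw m p q), ?_,
    fun t => ?_⟩
  · exact ((integrable_count_sq m p q).const_mul K).lintegral_lt_top.ne
  · exact lintegral_mono fun ω => ENNReal.ofReal_le_ofReal ((le_abs_self _).trans (h t ω))

lemma measurable_scanMean (f : ℤ × ℤ → ℝ) : Measurable (scanMean m p q f) := by
  have : Measurable fun y : ℝ × Draw × Draw => f (drawScan y.1 y.2) :=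
    (Measurable.of_discrete (f := f)).comp measurable_drawScan
  exact this.stronglyMeasurable.integral_prod_right'.measurable

lemma sum_ite_eq_toReal_sub (L : List Sample) (t : ℝ) (F : ℝ → ℝ) :
    (L.map fun x => if (x.1 : ℝ) < t then F x.1 else 0).sum =
      (L.map fun x => (Set.Iio t).indicator 1 (x.1 : ℝ) * ENNReal.ofReal (F x.1)).sum.toReal -
      (L.map fun x => (Set.Iio t).indicator 1 (x.1 : ℝ) * ENNReal.ofReal (-F x.1)).sum.toReal := by
  have hfin : ∀ (F : ℝ → ℝ) (L : List Sample),
      (L.map fun x => (Set.Iio t).indicator 1 (x.1 : ℝ) * ENNReal.ofReal (F x.1)).sum ≠ ∞ := by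
    intro F L
    induction L with
    | nil => simp
    | cons x L ih =>
      rw [List.map_cons, List.sum_cons]
      refine ENNReal.add_ne_top.2 ⟨?_, ih⟩
      by_cases h : (x.1 : ℝ) < t <;> simp [h]
  induction L with
  | nil => simp
  | cons x L ih =>
    simp only [List.map_cons, List.sum_cons]
    have hx : ∀ F : ℝ → ℝ,
        (Set.Iio t).indicator 1 (x.1 : ℝ) * ENNReal.ofReal (F x.1) ≠ ∞ := by
      intro F
      by_cases h : (x.1 : ℝ) < t <;> simp [h]
    rw [ENNReal.toReal_add (hx F) (hfin F L),
      ENNReal.toReal_add (hx fun y => -F y) (hfin (fun y => -F y) L), ih]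
    by_cases h : (x.1 : ℝ) < t
    · simp only [h, if_true, Set.mem_Iio, Set.indicator_of_mem, Pi.one_apply, one_mul,
        ENNReal.toReal_ofReal']
      have : max (F x.1) 0 - max (-F x.1) 0 = F x.1 := by
        simp
      linarith
    · simp [h]

/-- From nonnegative to real-valued integrands in Mecke's formula. -/
lemma integral_sum_of_lintegral_sum {r : Density} {pr : Draw × Draw → Draw} (hpr : Measurable pr)
    (hm : 0 ≤ m) (t : ℝ)
    (h : ∀ K : ℤ × ℤ → ℝ≥0∞,
      ∫⁻ ω, ((pr ω).samples.map fun x =>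
        (Set.Iio t).indicator 1 (x.1 : ℝ) * K (drawScan x.1 ω)).sum ∂(testLaw m p q) =
      ENNReal.ofReal m * ∫⁻ x : I, (Set.Iio t).indicator 1 (x : ℝ) *
        ∫⁻ ω, K (drawScan x ω) ∂(testLaw m p q) ∂r.law)
    (hf : QuadraticGrowth f) :
    Integrable (fun ω => ((pr ω).samples.map fun x =>
      if (x.1 : ℝ) < t then f (drawScan x.1 ω) else 0).sum) (testLaw m p q) ∧
    ∫ ω, ((pr ω).samples.map fun x =>
      if (x.1 : ℝ) < t then f (drawScan x.1 ω) else 0).sum ∂(testLaw m p q) =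
      m * ∫ x : I, (if (x : ℝ) < t then scanMean m p q f x else 0) ∂r.law := by
  have hg : Measurable ((Set.Iio t).indicator (1 : ℝ → ℝ≥0∞)) :=
    measurable_one.indicator measurableSet_Iio
  have hpart : ∀ f : ℤ × ℤ → ℝ, QuadraticGrowth f →
      Integrable (fun ω => ((pr ω).samples.map fun x => (Set.Iio t).indicator 1 (x.1 : ℝ) *
        ENNReal.ofReal (f (drawScan x.1 ω))).sum.toReal) (testLaw m p q) ∧
      ∫ ω, ((pr ω).samples.map fun x => (Set.Iio t).indicator 1 (x.1 : ℝ) *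
        ENNReal.ofReal (f (drawScan x.1 ω))).sum.toReal ∂(testLaw m p q) =
        m * ∫ x : I, ((Set.Iio t).indicator 1 (x : ℝ) *
          ∫⁻ ω, ENNReal.ofReal (f (drawScan x ω)) ∂(testLaw m p q)).toReal ∂r.law ∧
      Integrable (fun x : I => ((Set.Iio t).indicator 1 (x : ℝ) *
          ∫⁻ ω, ENNReal.ofReal (f (drawScan x ω)) ∂(testLaw m p q)).toReal) r.law := by
    intro f hf
    obtain ⟨B, hB, hle⟩ := hf.exists_lintegral_le m p q
    have hle' : ∀ x : I, (Set.Iio t).indicator 1 (x : ℝ) *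
        ∫⁻ ω, ENNReal.ofReal (f (drawScan x ω)) ∂(testLaw m p q) ≤ B := by
      intro x
      refine le_trans ?_ (hle x)
      by_cases hx : (x : ℝ) < t <;> simp [hx]
    have hmeas : Measurable fun x : I => (Set.Iio t).indicator 1 (x : ℝ) *
        ∫⁻ ω, ENNReal.ofReal (f (drawScan x ω)) ∂(testLaw m p q) := by
      refine (hg.comp measurable_subtype_coe).mul (Measurable.lintegral_prod_right'
        (f := fun y : I × Draw × Draw => ENNReal.ofReal (f (drawScan y.1 y.2))) ?_)
      exact (Measurable.of_discrete (f := fun st => ENNReal.ofReal (f st))).comp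
        (measurable_drawScan.comp (f := fun y : I × Draw × Draw => ((y.1 : ℝ), y.2)) (by fun_prop))
    have hlt : ∫⁻ x : I, (Set.Iio t).indicator 1 (x : ℝ) *
        ∫⁻ ω, ENNReal.ofReal (f (drawScan x ω)) ∂(testLaw m p q) ∂r.law ≠ ∞ := by
      refine ne_top_of_le_ne_top hB ((lintegral_mono hle').trans ?_)
      simp
    have hφ := measurable_sum_samples (measurable_test_integrand hg
      fun st => ENNReal.ofReal (f st)) hpr
    have hK := h fun st => ENNReal.ofReal (f st)
    have hfin : ∫⁻ ω, ((pr ω).samples.map fun x => (Set.Iio t).indicator 1 (x.1 : ℝ) *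
        ENNReal.ofReal (f (drawScan x.1 ω))).sum ∂(testLaw m p q) ≠ ∞ := by
      rw [hK]
      exact ENNReal.mul_ne_top ENNReal.ofReal_ne_top hlt
    refine ⟨integrable_toReal_of_lintegral_ne_top hφ.aemeasurable hfin, ?_,
      integrable_toReal_of_lintegral_ne_top hmeas.aemeasurable hlt⟩
    rw [integral_toReal hφ.aemeasurable (ae_lt_top hφ hfin), hK,
      integral_toReal hmeas.aemeasurable (ae_lt_top hmeas hlt), ENNReal.toReal_mul,
      ENNReal.toReal_ofReal hm]
  -- Mecke's formula holds for the positive and negative parts of `f` separately; both sides are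
  -- finite by quadratic growth, so they may be subtracted.
  obtain ⟨a1, a2, a3⟩ := hpart f hf
  obtain ⟨b1, b2, b3⟩ := hpart (fun st => -f st) hf.neg
  simp_rw [fun ω => sum_ite_eq_toReal_sub (pr ω).samples t fun x => f (drawScan x ω)]
  refine ⟨a1.sub b1, ?_⟩
  rw [integral_sub a1 b1, a2, b2, ← mul_sub, ← integral_sub a3 b3]
  congr 1
  refine integral_congr_ae (Filter.Eventually.of_forall fun x => ?_)
  simp only
  by_cases hx : (x : ℝ) < t
  · simp only [hx, if_true, Set.mem_Iio, Set.indicator_of_mem, Pi.one_apply, one_mul]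
    exact (integral_eq_lintegral_pos_part_sub_lintegral_neg_part (hf.integrable m p q x)).symm
  · simp [hx]

/-- Kolmogorov's forward equation for the scan. -/
lemma scanMean_eq (hm : 0 ≤ m) (hf : QuadraticGrowth f) (t : ℝ) :
    scanMean m p q f t = f (0, 0) +
      (m * ∫ x : I, (if (x : ℝ) < t then scanMean m p q (jump f true) x else 0) ∂p.law +
       m * ∫ x : I, (if (x : ℝ) < t then scanMean m p q (jump f false) x else 0) ∂q.law) := by
  have hg : Measurable ((Set.Iio t).indicator (1 : ℝ → ℝ≥0∞)) :=
    measurable_one.indicator measurableSet_Iio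
  obtain ⟨i1, e1⟩ := integral_sum_of_lintegral_sum m p q measurable_fst hm t
    (lintegral_sum_fst m p q hg) (hf.jump true)
  obtain ⟨i2, e2⟩ := integral_sum_of_lintegral_sum m p q measurable_snd hm t
    (lintegral_sum_snd m p q hg) (hf.jump false)
  rw [← e1, ← e2, ← integral_add i1 i2]
  have hc : f (0, 0) = ∫ _, f (0, 0) ∂(testLaw m p q) := by simp
  rw [hc]
  refine Eq.trans ?_ (integral_add (integrable_const _) (i1.add i2))
  refine integral_congr_ae ?_
  -- Almost surely the values are distinct, so `f` at time `t` telescopes into a sum over sample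
  -- points, split by source.
  filter_upwards [ae_config m p q] with ω hω
  rw [drawScan, scan_telescope f t hω.1]
  congr 1
  conv_lhs => rw [config, Multiset.map_coe, Multiset.sum_coe, List.map_append, List.sum_append,
    List.map_map, List.map_map]
  rfl

end Expectation

/-! ### Densities and intervals on the real line -/

/-- The density, extended by zero to the real line. -/
def Density.ext (r : Density) (x : ℝ) : ℝ :=
  if h : x ∈ Set.Icc (0 : ℝ) 1 then (r.pdf ⟨x, h⟩ : ℝ) else 0

namespace Density

variable (r : Density)

lemma ext_coe (x : I) : r.ext x = r.pdf x := by
  rw [ext, dif_pos x.2]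

lemma ext_nonneg (x : ℝ) : 0 ≤ r.ext x := by
  unfold ext
  split_ifs
  · exact NNReal.coe_nonneg _
  · exact le_rfl

lemma integral_law (G : ℝ → ℝ) :
    ∫ x : I, G x ∂r.law = ∫ x in (0 : ℝ)..1, r.ext x * G x := by
  rw [law, integral_withDensity_eq_integral_smul r.measurable_pdf,
    intervalIntegral.integral_of_le zero_le_one, ← integral_Icc_eq_integral_Ioc,
    ← integral_subtype measurableSet_Icc]
  refine integral_congr_ae (Filter.Eventually.of_forall fun x => ?_)
  simp only
  rw [ext_coe, NNReal.smul_def, smul_eq_mul]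

lemma integral_law_lt (G : ℝ → ℝ) {t : ℝ} (ht : t ∈ Set.Icc (0 : ℝ) 1) :
    ∫ x : I, (if (x : ℝ) < t then G x else 0) ∂r.law = ∫ x in (0 : ℝ)..t, r.ext x * G x := by
  rw [r.integral_law fun x => if x < t then G x else 0,
    intervalIntegral.integral_of_le zero_le_one, intervalIntegral.integral_of_le ht.1,
    integral_Ioc_eq_integral_Ioo (y := t), ← integral_indicator measurableSet_Ioc,
    ← integral_indicator measurableSet_Ioo]
  refine integral_congr_ae (Filter.Eventually.of_forall fun x => ?_)
  simp only [Set.indicator, Set.mem_Ioc, Set.mem_Ioo]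
  by_cases h : x < t
  · have : x ≤ 1 := h.le.trans ht.2
    simp [h, this]
  · simp [h]

lemma integrable_ext : IntervalIntegrable r.ext volume 0 1 := by
  rw [intervalIntegrable_iff_integrableOn_Icc_of_le zero_le_one, IntegrableOn,
    ← map_comap_subtype_coe measurableSet_Icc]
  refine ((MeasurableEmbedding.subtype_coe measurableSet_Icc).integrable_map_iff).2 ?_
  have e : r.ext ∘ ((↑) : I → ℝ) = fun x => (r.pdf x : ℝ) := funext fun x => r.ext_coe x
  rw [e]
  refine ⟨(measurable_coe_nnreal_real.comp r.measurable_pdf).aestronglyMeasurable, ?_⟩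
  rw [hasFiniteIntegral_iff_ofReal (Filter.Eventually.of_forall fun x => NNReal.coe_nonneg _)]
  simp_rw [ENNReal.ofReal_coe_nnreal]
  exact r.lintegral_pdf.trans_lt ENNReal.one_lt_top

lemma integral_ext : ∫ x in (0 : ℝ)..1, r.ext x = 1 := by
  have := r.integral_law fun _ => 1
  simpa using this.symm

/-- Up to null sets, an interval of `[0,1]` is given by its end points. -/
lemma exists_law_real_eq {J : Set I} (hJ : J.OrdConnected) :
    ∃ x y : ℝ, x ∈ Set.Icc (0 : ℝ) 1 ∧ y ∈ Set.Icc (0 : ℝ) 1 ∧ x ≤ y ∧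
      Set.Ioo x y ⊆ (↑) '' J ∧ ∀ r : Density, r.law.real J = ∫ u in x..y, r.ext u := by
  rcases J.eq_empty_or_nonempty with rfl | hne
  · exact ⟨0, 0, by simp, by simp, le_rfl, by simp, by simp⟩
  set S : Set ℝ := (↑) '' J with hS
  have hSI : S ⊆ Set.Icc 0 1 := by
    rintro _ ⟨u, -, rfl⟩
    exact u.2
  have hSne : S.Nonempty := hne.image _
  have hb : BddBelow S := ⟨0, fun u hu => (hSI hu).1⟩
  have ha : BddAbove S := ⟨1, fun u hu => (hSI hu).2⟩
  obtain ⟨s, hs⟩ := id hSne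
  have hsub : S ⊆ Set.Icc (sInf S) (sSup S) := fun u hu => ⟨csInf_le hb hu, le_csSup ha hu⟩
  have hIoo : Set.Ioo (sInf S) (sSup S) ⊆ S := by
    intro u hu
    obtain ⟨_, ⟨v, hv, rfl⟩, hvu⟩ := exists_lt_of_csInf_lt hSne hu.1
    obtain ⟨_, ⟨w, hw, rfl⟩, huw⟩ := exists_lt_of_lt_csSup hSne hu.2
    exact ⟨⟨u, v.2.1.trans hvu.le, huw.le.trans w.2.2⟩, hJ.out hv hw ⟨hvu.le, huw.le⟩, rfl⟩
  have hle : sInf S ≤ sSup S := (hsub hs).1.trans (hsub hs).2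
  refine ⟨sInf S, sSup S, ⟨le_csInf hSne fun u hu => (hSI hu).1, (hsub hs).1.trans (hSI hs).2⟩,
    ⟨(hSI hs).1.trans (hsub hs).2, csSup_le hSne fun u hu => (hSI hu).2⟩, hle, hIoo, fun r => ?_⟩
  have hJm : MeasurableSet J := hJ.measurableSet
  have hSm : MeasurableSet S :=
    (MeasurableEmbedding.subtype_coe measurableSet_Icc).measurableSet_image.2 hJm
  have hae : S =ᵐ[volume] Set.Ioo (sInf S) (sSup S) :=
    (hsub.eventuallyLE.trans Ioo_ae_eq_Icc.symm.le).antisymm hIoo.eventuallyLE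
  have e1 : r.law.real J = ∫ u : I, S.indicator (1 : ℝ → ℝ) u ∂r.law := by
    rw [← integral_indicator_one hJm]
    refine integral_congr_ae (Filter.Eventually.of_forall fun u => ?_)
    have hu : (u : ℝ) ∈ S ↔ u ∈ J := Subtype.val_injective.mem_set_image
    by_cases huJ : u ∈ J
    · simp [huJ, hu.2 huJ]
    · simp [huJ, mt hu.1 huJ]
  rw [e1, r.integral_law, intervalIntegral.integral_of_le zero_le_one,
    intervalIntegral.integral_of_le hle, integral_Ioc_eq_integral_Ioo (y := sSup S),
    ← setIntegral_congr_set hae, ← integral_Icc_eq_integral_Ioc]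
  have e2 : ∀ u, r.ext u * S.indicator (1 : ℝ → ℝ) u = S.indicator r.ext u := fun u => by
    by_cases hu : u ∈ S <;> simp [hu]
  simp_rw [e2]
  rw [setIntegral_indicator hSm, Set.inter_eq_right.2 hSI]

end Density

/-! ### The moment system of the scan -/

section System

variable (m : ℝ) (p q : Density) {f : ℤ × ℤ → ℝ}

lemma scanMean_zero (f : ℤ × ℤ → ℝ) : scanMean m p q f 0 = f (0, 0) := by
  have h : ∀ ω, drawScan 0 ω = (0, 0) := by
    intro ω
    rw [drawScan, scan, Multiset.filter_eq_nil.2]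
    · simp [scanList]
    · intro e he
      simp only [config, Multiset.mem_coe, List.mem_append, List.mem_map] at he
      rcases he with ⟨x, -, rfl⟩ | ⟨x, -, rfl⟩
      · exact not_lt.2 x.1.2.1
      · exact not_lt.2 x.1.2.1
  simp [scanMean, h]

lemma integrable_ext_mul_scanMean (r : Density) (hf : QuadraticGrowth f) :
    IntervalIntegrable (fun x => r.ext x * scanMean m p q f x) volume 0 1 := by
  obtain ⟨B, hB⟩ := hf.exists_scanMean_le m p q
  have h := r.integrable_ext
  rw [intervalIntegrable_iff] at h ⊢
  exact h.mul_bdd (measurable_scanMean m p q f).aestronglyMeasurable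
    (c := B) (Filter.Eventually.of_forall hB)

/-- The forward equation in differential form: at rate `m P` or `m Q` a sample arrives and changes
`f` by its jump. -/
lemma isPrimitive_scanMean (hm : 0 ≤ m) (hf : QuadraticGrowth f) :
    IsPrimitive (fun x => m * (p.ext x * scanMean m p q (jump f true) x
      + q.ext x * scanMean m p q (jump f false) x)) (scanMean m p q f) := by
  have h1 := integrable_ext_mul_scanMean m p q p (hf.jump true)
  have h2 := integrable_ext_mul_scanMean m p q q (hf.jump false)
  refine ⟨(h1.add h2).const_mul m, fun t ht => ?_⟩
  have hsub : Set.uIcc 0 t ⊆ Set.uIcc (0 : ℝ) 1 := by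
    rw [Set.uIcc_of_le ht.1, Set.uIcc_of_le zero_le_one]
    exact Set.Icc_subset_Icc_right ht.2
  rw [scanMean_eq m p q hm hf t, scanMean_zero, p.integral_law_lt _ ht, q.integral_law_lt _ ht,
    intervalIntegral.integral_const_mul, intervalIntegral.integral_add (h1.mono_set hsub)
    (h2.mono_set hsub), mul_add]

/-- The last sign, as a function of the state. -/
def lastSign (st : ℤ × ℤ) : ℝ := st.1

/-- The statistic, as a function of the state. -/
def value (st : ℤ × ℤ) : ℝ := st.2

lemma abs_lastSign_le {st : ℤ × ℤ} (h : |st.1| ≤ 1) : |lastSign st| ≤ 1 := by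
  rw [lastSign]
  exact_mod_cast h

lemma quadraticGrowth_lastSign : QuadraticGrowth lastSign := by
  refine ⟨1, zero_le_one, fun st h => (abs_lastSign_le h).trans ?_⟩
  have := abs_nonneg (st.2 : ℝ)
  nlinarith

lemma quadraticGrowth_value : QuadraticGrowth value := by
  refine ⟨1, zero_le_one, fun st h => ?_⟩
  have := abs_nonneg (st.2 : ℝ)
  rw [value]
  nlinarith

lemma quadraticGrowth_lastSign_mul_value : QuadraticGrowth fun st => lastSign st * value st := by
  refine ⟨1, zero_le_one, fun st h => ?_⟩
  rw [abs_mul]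
  have h1 := mul_le_of_le_one_left (abs_nonneg (value st)) (abs_lastSign_le h)
  have := abs_nonneg (st.2 : ℝ)
  rw [value] at *
  nlinarith

lemma quadraticGrowth_value_sq : QuadraticGrowth fun st => value st ^ 2 := by
  refine ⟨1, zero_le_one, fun st h => ?_⟩
  rw [abs_pow, value]
  have := abs_nonneg (st.2 : ℝ)
  nlinarith

lemma quadraticGrowth_lastSign_sq : QuadraticGrowth fun st => lastSign st ^ 2 := by
  refine ⟨1, zero_le_one, fun st h => ?_⟩
  rw [abs_pow]
  have h1 := pow_le_one₀ (n := 2) (abs_nonneg _) (abs_lastSign_le h)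
  have := abs_nonneg (st.2 : ℝ)
  nlinarith

lemma scanMean_const_mul (c : ℝ) (f : ℤ × ℤ → ℝ) (t : ℝ) :
    scanMean m p q (fun st => c * f st) t = c * scanMean m p q f t :=
  integral_const_mul _ _

lemma sign_sq (c : Bool) : (sign c : ℝ) ^ 2 = 1 := by cases c <;> simp [sign]

lemma scanMean_jump_lastSign (c : Bool) (t : ℝ) :
    scanMean m p q (jump lastSign c) t = sign c - scanMean m p q lastSign t := by
  refine (integral_sub (integrable_const (sign c : ℝ))
    (quadraticGrowth_lastSign.integrable m p q t)).trans ?_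
  simp [scanMean]

lemma scanMean_jump_value (c : Bool) (t : ℝ) :
    scanMean m p q (jump value c) t = sign c * scanMean m p q lastSign t := by
  rw [← scanMean_const_mul]
  congr 1
  funext st
  simp only [jump, value, step, lastSign]
  push_cast
  ring

lemma scanMean_jump_product (c : Bool) (t : ℝ) :
    scanMean m p q (jump (fun st => lastSign st * value st) c) t =
      sign c * scanMean m p q value t + scanMean m p q lastSign t
        - scanMean m p q (fun st => lastSign st * value st) t := by
  rw [← scanMean_const_mul]
  have h : jump (fun st => lastSign st * value st) c = fun st =>
      ((sign c : ℝ) * value st + lastSign st) - lastSign st * value st := by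
    funext st
    simp only [jump, value, step, lastSign]
    push_cast
    linear_combination (st.1 : ℝ) * sign_sq c
  rw [h]
  have h1 := (quadraticGrowth_value.integrable m p q t).const_mul (sign c : ℝ)
  have h2 := quadraticGrowth_lastSign.integrable m p q t
  refine (integral_sub (h1.add h2) (quadraticGrowth_lastSign_mul_value.integrable m p q t)).trans ?_
  exact congrArg₂ _ (integral_add h1 h2) rfl

lemma scanMean_jump_value_sq (c : Bool) (t : ℝ) :
    scanMean m p q (jump (fun st => value st ^ 2) c) t =
      2 * sign c * scanMean m p q (fun st => lastSign st * value st) t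
        + scanMean m p q (fun st => lastSign st ^ 2) t := by
  rw [← scanMean_const_mul]
  have h : jump (fun st => value st ^ 2) c = fun st =>
      2 * (sign c : ℝ) * (lastSign st * value st) + lastSign st ^ 2 := by
    funext st
    simp only [jump, value, step, lastSign]
    push_cast
    linear_combination (st.1 : ℝ) ^ 2 * sign_sq c
  rw [h]
  exact integral_add ((quadraticGrowth_lastSign_mul_value.integrable m p q t).const_mul _)
    (quadraticGrowth_lastSign_sq.integrable m p q t)

/-- The system closes because `(sign c)² = 1`: the jumps of `A`, `Z`, `A Z` and `Z²` are linear
combinations of the constant, these functions and `A²`, and `A²` need only be bounded. -/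
lemma scanSystem (hm : 0 < m) : ScanSystem m p.ext q.ext (scanMean m p q lastSign)
    (scanMean m p q value) (scanMean m p q fun st => lastSign st * value st)
    (scanMean m p q fun st => value st ^ 2) (scanMean m p q fun st => lastSign st ^ 2) where
  m_pos := hm
  P_int := p.integrable_ext
  Q_int := q.integrable_ext
  P_nonneg := p.ext_nonneg
  Q_nonneg := q.ext_nonneg
  P_one := p.integral_ext
  Q_one := q.integral_ext
  a_zero := by simp [scanMean_zero, lastSign]
  z_zero := by simp [scanMean_zero, value]
  w_zero := by simp [scanMean_zero, value]
  v_zero := by simp [scanMean_zero, value]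
  a_abs t := by
    refine abs_integral_le_integral_abs.trans ?_
    refine (integral_mono (quadraticGrowth_lastSign.integrable m p q t).abs (integrable_const 1)
      fun ω => abs_lastSign_le (abs_scan_fst_le _ _)).trans ?_
    simp
  b_le t := by
    refine (integral_mono (quadraticGrowth_lastSign_sq.integrable m p q t) (integrable_const 1)
      fun ω => ?_).trans ?_
    · exact (sq_le_one_iff_abs_le_one _).2 (abs_lastSign_le (abs_scan_fst_le _ _))
    · simp
  a_prim := (isPrimitive_scanMean m p q hm.le quadraticGrowth_lastSign).congr_deriv fun x _ => by
    rw [scanMean_jump_lastSign, scanMean_jump_lastSign]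
    simp only [sign, cond_true, cond_false]
    push_cast
    ring
  z_prim := (isPrimitive_scanMean m p q hm.le quadraticGrowth_value).congr_deriv fun x _ => by
    rw [scanMean_jump_value, scanMean_jump_value]
    simp only [sign, cond_true, cond_false]
    push_cast
    ring
  w_prim := (isPrimitive_scanMean m p q hm.le
      quadraticGrowth_lastSign_mul_value).congr_deriv fun x _ => by
    rw [scanMean_jump_product, scanMean_jump_product]
    simp only [sign, cond_true, cond_false]
    push_cast
    ring
  v_prim := (isPrimitive_scanMean m p q hm.le quadraticGrowth_value_sq).congr_deriv fun x _ => by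
    rw [scanMean_jump_value_sq, scanMean_jump_value_sq]
    simp only [sign, cond_true, cond_false]
    push_cast
    ring

end System

/-! ### From the distance to intervals, and parameter estimates -/

section Soundness

variable {k : ℕ} {ε m : ℝ} {p q : Density}

/-- Passing to `ε / 2` avoids the question whether the supremum is attained. -/
lemma exists_intervals_of_le_akDist (hε : 0 < ε) (h : ε ≤ akDist k p q) :
    ∃ x y : Fin k → ℝ, (∀ i, x i ∈ Set.Icc (0 : ℝ) 1) ∧ (∀ i, y i ∈ Set.Icc (0 : ℝ) 1) ∧
      (∀ i, x i ≤ y i) ∧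
      (Pairwise fun i j => Disjoint (Set.Ioo (x i) (y i)) (Set.Ioo (x j) (y j))) ∧
      ε / 2 ≤ ∑ i, |∫ u in (x i)..(y i), (p.ext u - q.ext u)| := by
  have hlt : ε / 2 < akDist k p q := by linarith
  have hne : Nonempty {J : Fin k → Set I // IsIntervalPartition k J} := by
    by_contra hempty
    rw [not_nonempty_iff] at hempty
    rw [akDist, Real.iSup_of_isEmpty] at h
    linarith
  obtain ⟨⟨J, hJ⟩, hsum⟩ := exists_lt_of_lt_ciSup hlt
  choose x y hx hy hxy hsub hreal using fun i => Density.exists_law_real_eq (hJ.1 i)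
  refine ⟨x, y, hx, hy, hxy, fun i j hij => ?_, hsum.le.trans_eq ?_⟩
  · exact Disjoint.mono (hsub i) (hsub j)
      ((Set.disjoint_image_iff Subtype.val_injective).2 (hJ.2.1 hij))
  · refine Finset.sum_congr rfl fun i _ => ?_
    have hi : Set.uIcc (x i) (y i) ⊆ Set.uIcc (0 : ℝ) 1 := by
      rw [Set.uIcc_of_le (zero_le_one' ℝ)]
      exact Set.uIcc_subset_Icc (hx i) (hy i)
    rw [hreal, hreal, intervalIntegral.integral_sub (p.integrable_ext.mono_set hi)
      (q.integrable_ext.mono_set hi)]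

end Soundness

section Parameters

variable {C c ε : ℝ} {k : ℕ}

lemma sampleParam_pos (hC : 0 < C) (hk : 0 < k) (hε : 0 < ε) : 0 < sampleParam C k ε := by
  have : (0 : ℝ) < k := by exact_mod_cast hk
  unfold sampleParam
  positivity

/-- Fifth powers clear the fractional exponents, so that all later estimates are polynomial. -/
lemma sampleParam_pow (hε : 0 < ε) : sampleParam C k ε ^ 5 * ε ^ 6 = C ^ 5 * (k : ℝ) ^ 4 := by
  have h1 : ((k : ℝ) ^ (4 / 5 : ℝ)) ^ 5 = (k : ℝ) ^ 4 := by
    rw [← Real.rpow_natCast, ← Real.rpow_mul (Nat.cast_nonneg k), ← Real.rpow_natCast]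
    norm_num
  have h2 : (ε ^ (6 / 5 : ℝ)) ^ 5 = ε ^ 6 := by
    rw [← Real.rpow_natCast, ← Real.rpow_mul hε.le, ← Real.rpow_natCast]
    norm_num
  rw [sampleParam, mul_pow, div_pow, h1, h2]
  field_simp

lemma pow_six_le (hc : 0 < c) (hk : 0 < k) (hε : c * (k : ℝ) ^ (-(1 / 6) : ℝ) ≤ ε) :
    c ^ 6 ≤ k * ε ^ 6 := by
  have hk' : (0 : ℝ) < k := by exact_mod_cast hk
  have h1 : ((k : ℝ) ^ (-(1 / 6) : ℝ)) ^ 6 = (k : ℝ)⁻¹ := by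
    rw [← Real.rpow_natCast, ← Real.rpow_mul hk'.le, ← Real.rpow_neg_one]
    norm_num
  have h2 := pow_le_pow_left₀ (by positivity) hε 6
  rw [mul_pow, h1] at h2
  have h3 := mul_le_mul_of_nonneg_left h2 hk'.le
  calc c ^ 6 = k * (c ^ 6 * (k : ℝ)⁻¹) := by field_simp
    _ ≤ _ := h3

lemma pow_fourteen_le (hc : 0 < c) (hk : 0 < k) (hε0 : 0 < ε)
    (hε : c * (k : ℝ) ^ (-(1 / 6) : ℝ) ≤ ε) : c ^ 14 ≤ (k : ℝ) ^ 4 * ε ^ 14 := by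
  have hk' : (1 : ℝ) ≤ k := by exact_mod_cast hk
  -- Cubing gives `k¹² ε⁴² = (k ε⁶)⁷ k⁵`, and the factor `k⁵` is at least `1`.
  refine le_of_pow_le_pow_left₀ (n := 3) (by norm_num) (by positivity) ?_
  calc (c ^ 14) ^ 3 = (c ^ 6) ^ 7 := by ring
    _ ≤ (k * ε ^ 6) ^ 7 := pow_le_pow_left₀ (by positivity) (pow_six_le hc hk hε) 7
    _ ≤ (k * ε ^ 6) ^ 7 * (k : ℝ) ^ 5 :=
        le_mul_of_one_le_right (by positivity) (one_le_pow₀ hk')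
    _ = _ := by ring

lemma le_sampleParam_mul_pow (hc : 0 < c) (hk : 0 < k) (hε0 : 0 < ε)
    (hε : c * (k : ℝ) ^ (-(1 / 6) : ℝ) ≤ ε) (hC1 : 1 ≤ C) (hC : 331776 ^ 5 / c ^ 14 ≤ C) :
    331776 ≤ sampleParam C k ε * ε ^ 4 := by
  have hm := sampleParam_pos (zero_lt_one.trans_le hC1) hk hε0
  refine le_of_pow_le_pow_left₀ (n := 5) (by norm_num) (by positivity) ?_
  rw [div_le_iff₀ (by positivity)] at hC
  calc (331776 : ℝ) ^ 5 ≤ C * c ^ 14 := hC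
    _ ≤ C ^ 5 * ((k : ℝ) ^ 4 * ε ^ 14) :=
        mul_le_mul (le_self_pow₀ hC1 (by norm_num)) (pow_fourteen_le hc hk hε0 hε)
          (by positivity) (by positivity)
    _ = (sampleParam C k ε * ε ^ 4) ^ 5 := by
        have := sampleParam_pow (C := C) (k := k) hε0
        -- The fifth power of `m ε⁴` is `m⁵ ε⁶ * ε¹⁴ = C⁵ k⁴ ε¹⁴`.
        linear_combination -ε ^ 14 * this

lemma le_sampleParam (hC : 72 ≤ C) (hk : 0 < k) (hε0 : 0 < ε) (hε : ε ≤ 2) :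
    18 ≤ sampleParam C k ε := by
  have hk' : (1 : ℝ) ≤ k := by exact_mod_cast hk
  have h1 : 1 ≤ (k : ℝ) ^ (4 / 5 : ℝ) := Real.one_le_rpow hk' (by norm_num)
  have h2 : ε ^ (6 / 5 : ℝ) ≤ 4 := by
    calc ε ^ (6 / 5 : ℝ) ≤ 2 ^ (6 / 5 : ℝ) := Real.rpow_le_rpow hε0.le hε (by norm_num)
      _ ≤ 2 ^ (2 : ℝ) := Real.rpow_le_rpow_of_exponent_le (by norm_num) (by norm_num)
      _ = 4 := by norm_num
  have h3 : 1 / 4 ≤ (k : ℝ) ^ (4 / 5 : ℝ) / ε ^ (6 / 5 : ℝ) :=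
    div_le_div₀ (by positivity) h1 (by positivity) h2
  rw [sampleParam]
  nlinarith

end Parameters

/-! ### Chebyshev bounds for the error probabilities -/

section Chebyshev

variable {Ω : Type*} [MeasurableSpace Ω] {μ : Measure Ω} [IsProbabilityMeasure μ]

lemma integral_sub_const_sq {X : Ω → ℝ} (hX : Integrable X μ)
    (hX2 : Integrable (fun ω => X ω ^ 2) μ) (c : ℝ) :
    Integrable (fun ω => (X ω - c) ^ 2) μ ∧
      ∫ ω, (X ω - c) ^ 2 ∂μ = ∫ ω, X ω ^ 2 ∂μ - 2 * c * ∫ ω, X ω ∂μ + c ^ 2 := by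
  have h1 : Integrable (fun ω => X ω ^ 2 - 2 * c * X ω) μ := hX2.sub (hX.const_mul (2 * c))
  have e : (fun ω => (X ω - c) ^ 2) = fun ω => (X ω ^ 2 - 2 * c * X ω) + c ^ 2 := by
    funext ω
    ring
  rw [e]
  refine ⟨h1.add (integrable_const _), ?_⟩
  rw [integral_add h1 (integrable_const _), integral_sub hX2 (hX.const_mul (2 * c)),
    integral_const_mul]
  simp

lemma measure_le_of_integral_le {F : Ω → ℝ} (hF : Integrable F μ) (h0 : ∀ ω, 0 ≤ F ω) {a b δ : ℝ}
    (ha : 0 < a) (hb : ∫ ω, F ω ∂μ ≤ b) (hδ : b ≤ δ * a) {s : Set Ω} (hs : ∀ ω ∈ s, a ≤ F ω) :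
    μ s ≤ ENNReal.ofReal δ := by
  have h1 := mul_meas_ge_le_integral_of_nonneg (Filter.Eventually.of_forall h0) hF a
  have h2 : μ.real {ω | a ≤ F ω} ≤ δ := by
    refine le_of_mul_le_mul_left ?_ ha
    linarith
  calc μ s ≤ μ {ω | a ≤ F ω} := measure_mono hs
    _ = ENNReal.ofReal (μ.real {ω | a ≤ F ω}) := (ofReal_measureReal).symm
    _ ≤ _ := ENNReal.ofReal_le_ofReal h2

lemma two_thirds_le_of_compl {s : Set Ω}
    (h : μ sᶜ ≤ ENNReal.ofReal (1 / 3)) : 2 / 3 ≤ μ s := by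
  have h1 : (1 : ℝ≥0∞) ≤ μ s + μ sᶜ := by
    rw [← measure_univ (μ := μ), ← Set.union_compl_self s]
    exact measure_union_le _ _
  have h2 : (2 / 3 : ℝ≥0∞) = 1 - ENNReal.ofReal (1 / 3) := by
    rw [← ENNReal.ofReal_one, ← ENNReal.ofReal_sub _ (by norm_num), show (1 - 1 / 3 : ℝ) = 2 / 3 by
      norm_num, ENNReal.ofReal_div_of_pos (by norm_num)]
    norm_num
  rw [h2, tsub_le_iff_right]
  exact h1.trans (add_le_add_right h _)

end Chebyshev

lemma ae_answer (m : ℝ) (p q : Density) : ∀ᵐ ω ∂(testLaw m p q),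
    (answer m ω = Answer.yes ↔ value (drawScan 1 ω) ≤ 3 * √m) ∧
    (answer m ω = Answer.no ↔ 3 * √m < value (drawScan 1 ω)) := by
  filter_upwards [ae_drawScan_one m p q] with ω hω
  rw [value, hω, answer, simpleTester]
  split_ifs with h
  · simpa using h
  · simpa using h

section Tester

variable {m : ℝ} (hm : 0 < m) (p q : Density)
include hm

/-- A Poisson variable has variance `m`, and exceeding `2 m` is a deviation of more than `m` from
its mean. -/
lemma measure_count_gt {N : Draw × Draw → ℕ}
    (hN : MeasurePreserving N (testLaw m p q) (poissonMeasure m.toNNReal)) :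
    testLaw m p q {ω | ¬ (N ω : ℝ) ≤ 2 * m} ≤ ENNReal.ofReal (1 / m) := by
  have hsq := integrable_poisson_sq m.toNNReal
  have hid : Integrable (fun n : ℕ => (n : ℝ)) (poissonMeasure m.toNNReal) := by
    refine (hsq.add (integrable_const 1)).mono' Measurable.of_discrete.aestronglyMeasurable
      (Filter.Eventually.of_forall fun n => ?_)
    rw [Real.norm_of_nonneg (Nat.cast_nonneg n), Pi.add_apply]
    nlinarith [sq_nonneg ((n : ℝ) - 1)]
  have e1 : ∫ n : ℕ, (n : ℝ) ∂(poissonMeasure m.toNNReal) = m := by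
    rw [integral_eq_lintegral_of_nonneg_ae (Filter.Eventually.of_forall fun n => Nat.cast_nonneg n)
      Measurable.of_discrete.aestronglyMeasurable]
    simp_rw [ENNReal.ofReal_natCast]
    rw [lintegral_poisson_id]
    simp [hm.le]
  have e2 : ∫ n : ℕ, (n : ℝ) ^ 2 ∂(poissonMeasure m.toNNReal) = m * (m + 1) := by
    rw [integral_eq_lintegral_of_nonneg_ae (Filter.Eventually.of_forall fun n => by positivity)
      Measurable.of_discrete.aestronglyMeasurable]
    have : ∀ n : ℕ, ENNReal.ofReal ((n : ℝ) ^ 2) = (n : ℝ≥0∞) ^ 2 := fun n => by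
      rw [ENNReal.ofReal_pow (by positivity), ENNReal.ofReal_natCast]
    simp_rw [this]
    rw [lintegral_poisson_sq, ENNReal.toReal_mul, ENNReal.toReal_add (by simp) (by simp)]
    simp [hm.le]
  obtain ⟨hI, e⟩ := integral_sub_const_sq hid hsq m
  rw [e1, e2] at e
  have h := measure_le_of_integral_le (μ := poissonMeasure m.toNNReal) hI
    (fun n => sq_nonneg _) (pow_pos hm 2) e.le (δ := 1 / m) (by field_simp; linarith)
    (s := {n : ℕ | ¬ (n : ℝ) ≤ 2 * m}) (fun n hn => by
      have hn' : 2 * m < n := not_le.1 hn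
      exact pow_le_pow_left₀ hm.le (by linarith) 2)
  rw [← hN.measure_preimage (MeasurableSet.of_discrete).nullMeasurableSet] at h
  exact h

/-- Markov's inequality for `Z²`: second moment at most `2 m` against the squared threshold `9 m`.
-/
lemma measure_statistic_gt (hpq : p.pdf =ᵐ[volume] q.pdf) :
    testLaw m p q {ω | 3 * √m < value (drawScan 1 ω)} ≤ ENNReal.ofReal (2 / 9) := by
  have hae : ∀ᵐ x : ℝ, x ∈ Set.Icc (0 : ℝ) 1 → p.ext x = q.ext x := by
    rw [← ae_restrict_iff' measurableSet_Icc, ← map_comap_subtype_coe measurableSet_Icc,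
      (MeasurableEmbedding.subtype_coe measurableSet_Icc).ae_map_iff]
    filter_upwards [hpq] with x hx
    exact (p.ext_coe x).trans ((congrArg _ hx).trans (q.ext_coe x).symm)
  have hv := (scanSystem m p q hm).second_moment_le_of_eq hae
  refine measure_le_of_integral_le (quadraticGrowth_value_sq.integrable m p q 1)
    (fun ω => sq_nonneg _) (a := 9 * m) (by positivity) hv (by linarith) fun ω hω => ?_
  have h1 : (0 : ℝ) ≤ √m := Real.sqrt_nonneg m
  have h2 := Real.sq_sqrt hm.le
  have h3 : 3 * √m < value (drawScan 1 ω) := hω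
  nlinarith

/-- The mean is at least `18 √m`, so a wrong answer is a deviation of at least `15 √m`; the variance
bound gives `10 m / (225 m) = 2 / 45`. -/
lemma measure_statistic_le {k : ℕ} {ε C c : ℝ} (hc : 0 < c) (hk : 0 < k) (hε0 : 0 < ε)
    (hε : c * (k : ℝ) ^ (-(1 / 6) : ℝ) ≤ ε) (hC1 : 27648 ^ 2 ≤ C)
    (hC : 331776 ^ 5 / c ^ 14 ≤ C) (hmC : m = sampleParam C k ε) (hak : ε ≤ akDist k p q) :
    testLaw m p q {ω | value (drawScan 1 ω) ≤ 3 * √m} ≤ ENNReal.ofReal (2 / 45) := by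
  have H := scanSystem m p q hm
  have hk' : (0 : ℝ) < k := by exact_mod_cast hk
  have hC1' : 1 ≤ C := le_trans (by norm_num) hC1
  set z := scanMean m p q value 1 with hz
  obtain ⟨x, y, hx, hy, hxy, hd, hdist⟩ := exists_intervals_of_le_akDist hε0 hak
  -- The target is `18² = 324`. The two alternatives need `331776 = 324 * 32²` and `27648 = 18 *
  -- 1536`.
  have hz2 : 0 ≤ z ∧ 324 * m ≤ z ^ 2 := by
    rcases H.mean_ge hk hε0 hx hy hxy hd hdist with h | h
    · have h0 : 0 ≤ m * ε ^ 2 / 32 := by positivity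
      refine ⟨h0.trans h, ?_⟩
      have h1 := pow_le_pow_left₀ h0 h 2
      have h2 := le_sampleParam_mul_pow hc hk hε0 hε hC1' hC
      rw [← hmC] at h2
      have h3 := mul_le_mul_of_nonneg_left h2 hm.le
      calc 324 * m = m * 331776 / 1024 := by ring
        _ ≤ m * (m * ε ^ 4) / 1024 := by linarith
        _ = (m * ε ^ 2 / 32) ^ 2 := by ring
        _ ≤ z ^ 2 := h1
    · have h0 : 0 ≤ m ^ 3 * ε ^ 3 / (1536 * k ^ 2) := by positivity
      refine ⟨h0.trans h, ?_⟩
      have h1 := pow_le_pow_left₀ h0 h 2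
      have h2 := sampleParam_pow (C := C) (k := k) hε0
      rw [← hmC] at h2
      have h4 : 27648 ^ 2 ≤ C ^ 5 := hC1.trans (le_self_pow₀ hC1' (by norm_num))
      have h5 := mul_le_mul_of_nonneg_left h4 hm.le
      -- This is where the exponents in the sample size balance: `m⁶ ε⁶ / k⁴ = m C⁵`.
      have e : (m ^ 3 * ε ^ 3 / (1536 * k ^ 2)) ^ 2 = m * C ^ 5 / 1536 ^ 2 := by
        rw [div_pow, div_eq_div_iff (by positivity) (by positivity)]
        linear_combination m * 1536 ^ 2 * h2
      calc 324 * m = m * 27648 ^ 2 / 1536 ^ 2 := by ring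
        _ ≤ m * C ^ 5 / 1536 ^ 2 := by linarith
        _ ≤ z ^ 2 := e ▸ h1
  have hs : 18 * √m ≤ z := by
    refine le_of_sq_le_sq ?_ hz2.1
    rw [mul_pow, Real.sq_sqrt hm.le]
    linarith [hz2.2]
  have hval := quadraticGrowth_value.integrable m p q 1
  have hsq := quadraticGrowth_value_sq.integrable m p q 1
  obtain ⟨hI, e⟩ := integral_sub_const_sq hval hsq z
  have hvar : ∫ ω, (value (drawScan 1 ω) - z) ^ 2 ∂(testLaw m p q) ≤ 10 * m := by
    refine le_trans (le_of_eq ?_) H.variance_le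
    rw [e, show ∫ ω, value (drawScan 1 ω) ∂(testLaw m p q) = z from rfl, scanMean]
    ring
  refine measure_le_of_integral_le hI (fun ω => sq_nonneg _) (a := 225 * m) (by positivity)
    hvar (by linarith) fun ω hω => ?_
  have h1 : (0 : ℝ) ≤ √m := Real.sqrt_nonneg m
  have h2 := Real.sq_sqrt hm.le
  have h3 : value (drawScan 1 ω) ≤ 3 * √m := hω
  nlinarith

lemma measure_not_drawsAtMost :
    testLaw m p q {ω | ¬ drawsAtMost (2 * m) ω} ≤ ENNReal.ofReal (2 / m) := by
  have h1 := measure_count_gt hm p q (measurePreserving_count_fst m p q)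
  have h2 := measure_count_gt hm p q (measurePreserving_count_snd m p q)
  have hsub : {ω : Draw × Draw | ¬ drawsAtMost (2 * m) ω} ⊆
      {ω | ¬ (ω.1.1 : ℝ) ≤ 2 * m} ∪ {ω | ¬ (ω.2.1 : ℝ) ≤ 2 * m} := by
    intro ω hω
    simp only [drawsAtMost, Draw.length_samples, Set.mem_ofPred_eq, not_and_or] at hω
    exact hω
  refine (measure_mono hsub).trans ((measure_union_le _ _).trans ((add_le_add h1 h2).trans_eq ?_))
  rw [← ENNReal.ofReal_add (by positivity) (by positivity)]
  congr 1
  ring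

end Tester

end AkTesting

end

theorem mainTheorem5 (c : ℝ) (hc : 0 < c) :
    ∃ C₀ : ℝ, 0 < C₀ ∧ ∀ C : ℝ, C₀ ≤ C →
      ∀ k : ℕ, 2 < k → ∀ ε : ℝ, c * (k : ℝ) ^ (-(1 / 6) : ℝ) ≤ ε →
      ∀ p q : AkTesting.Density, ∀ m : ℝ, m = AkTesting.sampleParam C k ε →
        -- the expected number of samples from each distribution is `m`
        (∫⁻ ω, ((AkTesting.Draw.samples ω.1).length : ℝ≥0∞) ∂(AkTesting.testLaw m p q)
            = ENNReal.ofReal m ∧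
          ∫⁻ ω, ((AkTesting.Draw.samples ω.2).length : ℝ≥0∞) ∂(AkTesting.testLaw m p q)
            = ENNReal.ofReal m) ∧
        -- completeness
        (p.pdf =ᵐ[volume] q.pdf →
          2 / 3 ≤ (AkTesting.testLaw m p q) {ω | AkTesting.answer m ω = AkTesting.Answer.yes}) ∧
        -- soundness
        (ε ≤ AkTesting.akDist k p q →
          2 / 3 ≤ (AkTesting.testLaw m p q) {ω | AkTesting.answer m ω = AkTesting.Answer.no}) ∧
        -- the same guarantees, jointly with the bound `2 m` on both sample sizes;
        -- the `A_k`-distance never exceeds `2`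
        (ε ≤ 2 →
          (p.pdf =ᵐ[volume] q.pdf →
            2 / 3 ≤ (AkTesting.testLaw m p q)
              {ω | AkTesting.answer m ω = AkTesting.Answer.yes ∧
                AkTesting.drawsAtMost (2 * m) ω}) ∧
          (ε ≤ AkTesting.akDist k p q →
            2 / 3 ≤ (AkTesting.testLaw m p q)
              {ω | AkTesting.answer m ω = AkTesting.Answer.no ∧
                AkTesting.drawsAtMost (2 * m) ω})) := by
  -- The two summands serve the two lower bounds on the mean; the first also exceeds `72`, which
  -- gives `m ≥ 18` when `ε ≤ 2`.
  refine ⟨27648 ^ 2 + 331776 ^ 5 / c ^ 14, by positivity, ?_⟩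
  intro C hC k hk2 ε hε p q m hmC
  have hk : 0 < k := by omega
  have hk' : (0 : ℝ) < k := by exact_mod_cast hk
  have hε0 : 0 < ε := lt_of_lt_of_le (by positivity) hε
  have hC1 : 27648 ^ 2 ≤ C := le_trans (le_add_of_nonneg_right (by positivity)) hC
  have hC2 : 331776 ^ 5 / c ^ 14 ≤ C := le_trans (le_add_of_nonneg_left (by positivity)) hC
  have hm : 0 < m := hmC ▸ AkTesting.sampleParam_pos (lt_of_lt_of_le (by norm_num) hC1) hk hε0
  have hans := AkTesting.ae_answer m p q
  have hyes : p.pdf =ᵐ[volume] q.pdf → AkTesting.testLaw m p q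
      {ω | ¬ AkTesting.answer m ω = AkTesting.Answer.yes} ≤ ENNReal.ofReal (2 / 9) := by
    intro hpq
    refine (measure_mono_ae ?_).trans (AkTesting.measure_statistic_gt hm p q hpq)
    filter_upwards [hans] with ω hω h
    exact not_le.1 fun h' => h (hω.1.2 h')
  have hno : ε ≤ AkTesting.akDist k p q → AkTesting.testLaw m p q
      {ω | ¬ AkTesting.answer m ω = AkTesting.Answer.no} ≤ ENNReal.ofReal (2 / 9) := by
    intro hak
    refine (measure_mono_ae ?_).trans ((AkTesting.measure_statistic_le hm p q hc hk hε0 hε hC1 hC2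
      hmC hak).trans (ENNReal.ofReal_le_ofReal (by norm_num)))
    filter_upwards [hans] with ω hω h
    exact not_lt.1 fun h' => h (hω.2.2 h')
  have hsingle : ∀ s : Set (AkTesting.Draw × AkTesting.Draw),
      AkTesting.testLaw m p q sᶜ ≤ ENNReal.ofReal (2 / 9) → 2 / 3 ≤ AkTesting.testLaw m p q s :=
    fun s hs => AkTesting.two_thirds_le_of_compl
      (hs.trans (ENNReal.ofReal_le_ofReal (by norm_num)))
  have hjoint : ε ≤ 2 → ∀ s : Set (AkTesting.Draw × AkTesting.Draw),
      AkTesting.testLaw m p q sᶜ ≤ ENNReal.ofReal (2 / 9) →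
      2 / 3 ≤ AkTesting.testLaw m p q (s ∩ {ω | AkTesting.drawsAtMost (2 * m) ω}) := by
    intro hε2 s hs
    have hm18 : 18 ≤ m := hmC ▸ AkTesting.le_sampleParam (le_trans (by norm_num) hC1) hk hε0 hε2
    refine AkTesting.two_thirds_le_of_compl ?_
    rw [Set.compl_inter]
    refine (measure_union_le _ _).trans
      ((add_le_add hs (AkTesting.measure_not_drawsAtMost hm p q)).trans ?_)
    rw [← ENNReal.ofReal_add (by norm_num) (by positivity)]
    refine ENNReal.ofReal_le_ofReal ?_
    -- The total failure probability is at most `2 / 9 + 1 / 9 = 1 / 3`.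
    have : 2 / m ≤ 2 / 18 := by gcongr
    linarith
  exact ⟨⟨AkTesting.lintegral_length_fst m p q, AkTesting.lintegral_length_snd m p q⟩,
    fun h => hsingle _ (hyes h), fun h => hsingle _ (hno h),
    fun h2 => ⟨fun h => hjoint h2 _ (hyes h), fun h => hjoint h2 _ (hno h)⟩⟩
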